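/- **Setting.** Let $n>2$ and let $\sigma:\mathbb R\to\mathbb R$ be continuous and not a polynomial. For a finite $G$-set $X$, the group $G$ acts on $\mathbb R^X$ by $g e_x=e_{gx}$; $\mathrm{Aff}_G(V,W)$ is the space of $G$-equivariant affine maps. Let $\mathbb Z_n$ and $S_n$ act on $[n]$ by cyclic shifts and by permutations, trivially on $\mathbb R$, and let $S_n$ act on itself by left multiplication. For a space $M$ of affine maps $V\to\mathbb R^Y$ and a space $N$ of affine maps $\mathbb R^Y\to Z$, let $\mathcal N(M,N)\subseteq C(V,Z)$ be the set of all shallow networks $x\mapsto\sum_{j=1}^h g_j(\sigma(f_j(x)))$ with $h\in\mathbb N$, $f_j\in M$, $g_j\in N$ and $\sigma$ applied coordinatewise, and let $\mathcal U(M,N)$ be its closure in $C(V,Z)$ for uniform convergence on compact sets. Write $\mathcal U(V,W,Z)=\mathcal U(\mathrm{Aff}_{S_n}(V,W),\mathrm{Aff}_{S_n}(W,Z))$. Let $C^k$ be the space of maps $v\mapsto\sum_{i=1}^k x_iA(e_i)v+y\mathbb 1$ on $\mathbb R^n$, where $A(x)$ is the circulant matrix with first column $x$ (so $C^1=\{v\mapsto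 xv+y\mathbb 1\}$), and let $I=\mathrm{Aff}_{\mathbb Z_n}(\mathbb R^n,\mathbb R)$. For a family $\mathcal N$ of maps, $\rho(\mathcal N)$ is the set of pairs $(\alpha,\beta)$ with $f(\alpha)=f(\beta)$ for all $f\in\mathcal N$. A family $\mathcal N\subseteq C(V,Z)$ is *separation-constrained universal* if its closure is the set of all continuous functions (for a family of $G$-equivariant maps: of all continuous $G$-equivariant maps) $V\to Z$ that respect $\rho(\mathcal N)$. **Proposition.** 1. (Invariant models.) The classes $\mathcal U(C^1,I)$, $\mathcal U(\mathbb R^n,\mathbb R^n,\mathbb R)$ and $\mathcal U(\mathbb R^n,\mathbb R^{S_n},\mathbb R)$ have the same separation relation $\rho$, and $$\mathcal U(C^1,I)\subsetneq\mathcal U(\mathbb R^n,\mathbb R^n,\mathbb R)\subsetneq\mathcal U(\mathbb R^n,\mathbb R^{S_n},\mathbb R).$$ The function $(x_1+\dots+x_n)^n$ belongs to the second class and not to the first. If $n>3$, the function $x_1\cdots x_n$ belongs to the third class and not to the second. Neither the width-1 CNNs $\mathcal N(C^1,I)$ nor the shallow PointNets $\mathcal N(\mathrm{Aff}_{S_n}(\mathbb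 R^n,\mathbb R^n),\mathrm{Aff}_{S_n}(\mathbb R^n,\mathbb R))$ are separation-constrained universal. 2. (Equivariant models with output $\mathbb R^n$.) The classes $\mathcal U(C^1,C^1)$, $\mathcal U(\mathbb R^n,\mathbb R^n,\mathbb R^n)$ and $\mathcal U(\mathbb R^n,\mathbb R^{S_n},\mathbb R^n)$ have the same separation relation, and $$\mathcal U(C^1,C^1)\subsetneq\mathcal U(\mathbb R^n,\mathbb R^n,\mathbb R^n)\subsetneq\mathcal U(\mathbb R^n,\mathbb R^{S_n},\mathbb R^n).$$ For no $1\le k\le n$ is the family $\mathcal N(C^1,C^k)$ of $\mathbb Z_n$-equivariant maps separation-constrained universal. 3. (Equivariant models with arbitrary output.) For every nonempty finite $S_n$-set $Y$, $$\mathcal U(C^1,\mathrm{Aff}_{S_n}(\mathbb R^n,\mathbb R^Y))\subsetneq\mathcal U(\mathbb R^n,\mathbb R^n,\mathbb R^Y)\subsetneq\mathcal U(\mathbb R^n,\mathbb R^{S_n},\mathbb R^Y),$$ and neither of the families of $S_n$-equivariant maps $\mathcal N(C^1,\mathrm{Aff}_{S_n}(\mathbb R^n,\mathbb R^Y))$ and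 $\mathcal N(\mathrm{Aff}_{S_n}(\mathbb R^n,\mathbb R^n),\mathrm{Aff}_{S_n}(\mathbb R^n,\mathbb R^Y))$ is separation-constrained universal. -/

import Mathlib

open scoped BigOperators

namespace EquivariantNetworks

/-- The permutation representation of `G` on `ℝ^X = (X → ℝ)`: `g • e_x = e_{g x}`,
that is, `(g • v) x = v (g⁻¹ x)`. -/
def permRep (G X : Type*) [Group G] [MulAction G X] : Representation ℝ G (X → ℝ) where
  toFun g := LinearMap.funLeft ℝ ℝ (fun x : X => g⁻¹ • x)
  map_one' := by
    ext v x
    simp [LinearMap.funLeft]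
  map_mul' g h := by
    ext v x
    simp [LinearMap.funLeft, mul_smul]

/-- `Aff_G(V, Z)`: the space of `G`-equivariant affine maps between two representations. -/
def equivAff {G V Z : Type*} [Group G] [AddCommGroup V] [Module ℝ V]
    [AddCommGroup Z] [Module ℝ Z] (ρ : Representation ℝ G V) (τ : Representation ℝ G Z) :
    Submodule ℝ (V →ᵃ[ℝ] Z) where
  carrier := {f | ∀ (g : G) (v : V), f (ρ g v) = τ g (f v)}
  zero_mem' := by
    intro g v
    simp
  add_mem' := by
    intro a b ha hb g v
    simp [ha g v, hb g v]
  smul_mem' := by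
    intro c a ha g v
    simp [ha g v]

/-- The point-wise activation `ℝ^X → ℝ^X` induced by `σ : ℝ → ℝ`. -/
def pointwise (σ : ℝ → ℝ) {X : Type*} (v : X → ℝ) : X → ℝ := fun x => σ (v x)

/-- `N_σ(M¹, M²)`: the shallow neural networks with layers in `M¹`, `M²` and activation `σ`. -/
def shallowNeuralSpace (σ : ℝ → ℝ) {V X Z : Type*} [AddCommGroup V] [Module ℝ V]
    [AddCommGroup Z] [Module ℝ Z]
    (M₁ : Set (V →ᵃ[ℝ] (X → ℝ))) (M₂ : Set ((X → ℝ) →ᵃ[ℝ] Z)) : Set (V → Z) :=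
  {F | ∃ φ ∈ M₂, ∃ η ∈ M₁, F = φ ∘ pointwise σ ∘ η}

/-- `M_h = {x ↦ (f₁ x, …, f_h x) | f_j ∈ M}`, where `ℝ^Y ⊗ ℝ^h` is realised as `ℝ^(Y × [h])`. -/
def widen {V Y : Type*} [AddCommGroup V] [Module ℝ V]
    (M : Submodule ℝ (V →ᵃ[ℝ] (Y → ℝ))) (h : ℕ) : Set (V →ᵃ[ℝ] (Y × Fin h → ℝ)) :=
  {F | ∃ f : Fin h → (V →ᵃ[ℝ] (Y → ℝ)), (∀ j, f j ∈ M) ∧ ∀ v y j, F v (y, j) = f j v y}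

/-- `_hN = {(x₁, …, x_h) ↦ g₁ x₁ + ⋯ + g_h x_h | g_j ∈ N}`. -/
def pool {Y Z : Type*} [AddCommGroup Z] [Module ℝ Z]
    (N : Submodule ℝ ((Y → ℝ) →ᵃ[ℝ] Z)) (h : ℕ) : Set ((Y × Fin h → ℝ) →ᵃ[ℝ] Z) :=
  {F | ∃ g : Fin h → ((Y → ℝ) →ᵃ[ℝ] Z), (∀ j, g j ∈ N) ∧
    ∀ w, F w = ∑ j, g j (fun y => w (y, j))}

section Classes

variable {V Y Z : Type*} [AddCommGroup V] [Module ℝ V] [TopologicalSpace V]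
  [AddCommGroup Z] [Module ℝ Z] [TopologicalSpace Z]

/-- The union over all widths `h` of the neural spaces `N_σ(M_h, _hN)`, inside `C(V, Z)`. -/
def networks (σ : ℝ → ℝ) (M : Submodule ℝ (V →ᵃ[ℝ] (Y → ℝ)))
    (N : Submodule ℝ ((Y → ℝ) →ᵃ[ℝ] Z)) : Set C(V, Z) :=
  {F | ∃ h : ℕ, (F : V → Z) ∈ shallowNeuralSpace σ (widen M h) (pool N h)}

/-- The universality class `U(M, N)`: the closure of the networks of all widths in `C(V, Z)`.
The topology of `C(V, Z)` is the compact-open one, i.e. uniform convergence on compact sets. -/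
def universalityClass (σ : ℝ → ℝ) (M : Submodule ℝ (V →ᵃ[ℝ] (Y → ℝ)))
    (N : Submodule ℝ ((Y → ℝ) →ᵃ[ℝ] Z)) : Set C(V, Z) :=
  closure (networks σ M N)

end Classes

section Separation

variable {X Z : Type*} [TopologicalSpace X] [TopologicalSpace Z]

/-- `ρ(𝒩)`: the pairs of points that no member of the family `𝒩` separates. -/
def sepRel (𝒩 : Set C(X, Z)) : Set (X × X) :=
  {p | ∀ f ∈ 𝒩, f p.1 = f p.2}

/-- `C_ρ`: the continuous functions that respect the relation `ρ`. -/
def respecting (R : Set (X × X)) : Set C(X, Z) :=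
  {f | ∀ p ∈ R, f p.1 = f p.2}

/-- Separation-constrained universality of the family `𝒩`: its closure is the set of all
continuous functions that respect `ρ(𝒩)`. -/
def IsSepUniversal (𝒩 : Set C(X, Z)) : Prop :=
  closure 𝒩 = respecting (sepRel 𝒩)

/-- Separation-constrained universality of a family of equivariant maps: its closure is the set of
all continuous equivariant maps that respect `ρ(𝒩)`. -/
def IsEquivSepUniversal {G V W : Type*} [Group G] [AddCommGroup V] [Module ℝ V]
    [TopologicalSpace V] [AddCommGroup W] [Module ℝ W] [TopologicalSpace W]
    (ρ : Representation ℝ G V) (τ : Representation ℝ G W) (𝒩 : Set C(V, W)) : Prop :=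
  closure 𝒩 = {f ∈ respecting (sepRel 𝒩) | ∀ (g : G) (v : V), f (ρ g v) = τ g (f v)}

end Separation

section Examples

variable (n : ℕ)

/-- The symmetric group `S_n`. -/
abbrev SymGroup : Type := Equiv.Perm (Fin n)

/-- `ℤ_n`, acting on `[n]` by modular shifts. -/
def cyclicShifts : Subgroup (SymGroup n) := Subgroup.zpowers (finRotate n)

/-- `C^k`: circular convolutional layers `v ↦ ∑_{i ≤ k} x_i A(e_i) v + y 𝟙` of filter width `k`,
where `A(x)` is the circulant matrix with first column `x`. -/
def convLayer (k : ℕ) : Submodule ℝ ((Fin n → ℝ) →ᵃ[ℝ] (Fin n → ℝ)) where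
  carrier := {f | ∃ (x : Fin n → ℝ) (y : ℝ), ∀ v : Fin n → ℝ,
    f v = (∑ i : Fin n with i.val < k,
      x i • (Matrix.circulant (Pi.single i (1 : ℝ))).mulVec v) + y • (1 : Fin n → ℝ)}
  zero_mem' := ⟨0, 0, fun v => by simp⟩
  add_mem' := by
    rintro f g ⟨x, y, hf⟩ ⟨x', y', hg⟩
    refine ⟨x + x', y + y', fun v => ?_⟩
    simp only [AffineMap.coe_add, hf v, hg v, Pi.add_apply, add_smul, Finset.sum_add_distrib]
    abel
  smul_mem' := by
    rintro c f ⟨x, y, hf⟩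
    refine ⟨c • x, c * y, fun v => ?_⟩
    simp only [AffineMap.coe_smul, hf v, Pi.smul_apply, smul_add, Finset.smul_sum, smul_smul,
      smul_eq_mul]

/-- `I = Aff_{ℤ_n}(ℝ^n, ℝ)`: invariant circular layers. -/
def invLayer : Submodule ℝ ((Fin n → ℝ) →ᵃ[ℝ] ℝ) :=
  equivAff (permRep (cyclicShifts n) (Fin n)) (Representation.trivial ℝ (cyclicShifts n) ℝ)

/-- `Aff_{S_n}(ℝ^X, ℝ^Y)` for `S_n`-sets `X` and `Y`. -/
def symAff (X Y : Type*) [MulAction (SymGroup n) X] [MulAction (SymGroup n) Y] :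
    Submodule ℝ ((X → ℝ) →ᵃ[ℝ] (Y → ℝ)) :=
  equivAff (permRep (SymGroup n) X) (permRep (SymGroup n) Y)

/-- `Aff_{S_n}(ℝ^X, ℝ)`, with `S_n` acting trivially on `ℝ`. -/
def symInv (X : Type*) [MulAction (SymGroup n) X] : Submodule ℝ ((X → ℝ) →ᵃ[ℝ] ℝ) :=
  equivAff (permRep (SymGroup n) X) (Representation.trivial ℝ (SymGroup n) ℝ)

/-- `U(C¹, I)`. -/
def cnnClass (σ : ℝ → ℝ) : Set C(Fin n → ℝ, ℝ) :=
  universalityClass σ (convLayer n 1) (invLayer n)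

/-- `U(ℝⁿ, ℝⁿ, ℝ)`. -/
def pointNetClass (σ : ℝ → ℝ) : Set C(Fin n → ℝ, ℝ) :=
  universalityClass σ (symAff n (Fin n) (Fin n)) (symInv n (Fin n))

/-- `U(ℝⁿ, ℝ^{S_n}, ℝ)`, where `S_n` acts on itself by left multiplication. -/
def regularClass (σ : ℝ → ℝ) : Set C(Fin n → ℝ, ℝ) :=
  universalityClass σ (symAff n (Fin n) (SymGroup n)) (symInv n (SymGroup n))

/-- `U(C¹, C^k)`: the equivariant counterpart of `U(C¹, I)`. -/
def cnnEquivClass (k : ℕ) (σ : ℝ → ℝ) : Set C(Fin n → ℝ, Fin n → ℝ) :=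
  universalityClass σ (convLayer n 1) (convLayer n k)

/-- `U(C¹, Aff_{S_n}(ℝⁿ, ℝ^Y))`. -/
def pointwiseEquivClass (Y : Type*) [MulAction (SymGroup n) Y] (σ : ℝ → ℝ) :
    Set C(Fin n → ℝ, Y → ℝ) :=
  universalityClass σ (convLayer n 1) (symAff n (Fin n) Y)

/-- `U(ℝⁿ, ℝⁿ, ℝ^Y)`. -/
def pointNetEquivClass (Y : Type*) [MulAction (SymGroup n) Y] (σ : ℝ → ℝ) :
    Set C(Fin n → ℝ, Y → ℝ) :=
  universalityClass σ (symAff n (Fin n) (Fin n)) (symAff n (Fin n) Y)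

/-- `U(ℝⁿ, ℝ^{S_n}, ℝ^Y)`. -/
def regularEquivClass (Y : Type*) [MulAction (SymGroup n) Y] (σ : ℝ → ℝ) :
    Set C(Fin n → ℝ, Y → ℝ) :=
  universalityClass σ (symAff n (Fin n) (SymGroup n)) (symAff n (SymGroup n) Y)

/-- The function `(x₁ + ⋯ + x_n)^n`. -/
def sumPow : C(Fin n → ℝ, ℝ) := ⟨fun x => (∑ i, x i) ^ n, by fun_prop⟩

/-- The function `x₁ ⋯ x_n`. -/
def coordProd : C(Fin n → ℝ, ℝ) := ⟨fun x => ∏ i, x i, by fun_prop⟩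

end Examples

end EquivariantNetworks

open EquivariantNetworks

/-! Two mechanisms carry the theorem: density for the largest class, and annihilating functionals
for the smaller ones.

Density: the dilated translates of a continuous non-polynomial `σ` span a dense subspace of `C(ℝ,
ℝ)` (`eq_top_of_forall_dilate_mem`). Products of exponentials of linear forms are again such
exponentials, so ridge functions are dense in several variables (`eq_top_of_forall_ridge_mem`).
Averaging a ridge function over a finite group gives a network with regular hidden representation;
hence the regular class contains every continuous equivariant map
(`mem_universalityClass_of_map_rep`).

Annihilators: a signed combination of point evaluations with total weight zero kills a whole class
as soon as it kills the activated first layer (`sum_smul_eq_zero_of_mem_universalityClass`). Width-1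
layers act on each coordinate alone, so their networks are additive on disjoint supports, which `(∑
x)^n` violates. A hidden PointNet coordinate sees only `x_i` and `∑ x`; points with a common
coordinate sum whose weights cancel coordinate by coordinate give functionals that kill PointNets
but neither the discriminant nor, for `n > 3`, the product.

Separation: the sums `∑ f(x_i)` determine the multiset of coordinates, so the smallest invariant
class already separates `S_n`-orbits and the largest separates no more. With output `ℝⁿ` all points
are separated. Other outputs reduce to scalar functions times a fixed nonzero invariant vector `z`.
-/

/-! ### Density of dilates and of ridge functions -/

section UniversalApproximation

open Filter Topology MeasureTheory

/-- A function that is approximated uniformly on every compact set by members of `S` lies in the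
closure of `S` for the compact-open topology. -/
theorem mem_closure_of_forall_isCompact {X : Type*} [TopologicalSpace X] {S : Set C(X, ℝ)}
    {f : C(X, ℝ)}
    (h : ∀ K, IsCompact K → ∀ ε > 0, ∃ g ∈ S, ∀ x ∈ K, |g x - f x| < ε) : f ∈ closure S := by
  have hb := nhds_basis_uniformity'
    (ContinuousMap.hasBasis_compactConvergenceUniformity (α := X) (β := ℝ)) (x := f)
  rw [mem_closure_iff_nhds_basis hb]
  rintro ⟨K, U⟩ ⟨hK, hU⟩
  obtain ⟨ε, hε, hεU⟩ := Metric.mem_uniformity_dist.1 hU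
  obtain ⟨g, hg, hgK⟩ := h K hK ε hε
  refine ⟨g, hg, fun x hx => hεU ?_⟩
  rw [dist_comm, Real.dist_eq]
  exact hgK x hx

/-- A subalgebra that separates points is dense for the compact-open topology. -/
theorem mem_closure_of_separatesPoints {X : Type*} [TopologicalSpace X] {A : Subalgebra ℝ C(X, ℝ)}
    (hA : A.SeparatesPoints) (f : C(X, ℝ)) : f ∈ closure (A : Set C(X, ℝ)) := by
  refine mem_closure_of_forall_isCompact fun K hK ε hε => ?_
  obtain ⟨g, hg, h⟩ :=
    ContinuousMap.exists_mem_subalgebra_near_continuous_of_isCompact_of_separatesPoints hA f hK hε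
  exact ⟨g, hg, h⟩

/-- The integral of a function with values in a closed subspace lies in that subspace. -/
theorem integral_mem_of_isClosed {α E : Type*} [MeasurableSpace α] {μ : Measure α}
    [NormedAddCommGroup E] [NormedSpace ℝ E] [CompleteSpace E] {T : Submodule ℝ E}
    (hT : IsClosed (T : Set E)) {f : α → E} (hi : Integrable f μ) (hf : ∀ a, f a ∈ T) :
    ∫ a, f a ∂μ ∈ T := by
  have : IsClosed (T : Set E) := hT
  -- The quotient by a closed subspace is normed and its projection is continuous, hence commutes
  -- with the integral.
  have h : ∀ a, T.mkQL (f a) = 0 := fun a => (Submodule.Quotient.mk_eq_zero T).2 (hf a)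
  have h1 := T.mkQL.integral_comp_comm hi
  simp only [h, integral_zero] at h1
  exact (Submodule.Quotient.mk_eq_zero T).1 h1.symm

/-- Convolutions with compactly supported functions stay in a closed subspace that contains all
translates. -/
theorem convolution_mem_of_translates {S : Submodule ℝ C(ℝ, ℝ)} (hS : IsClosed (S : Set C(ℝ, ℝ)))
    {s φ : ℝ → ℝ} (hs : Continuous s) (hφ : Continuous φ) (hc : HasCompactSupport φ)
    (a b : ℝ) (hT : ∀ y, (⟨fun t => s (a * t + b - y), by fun_prop⟩ : C(ℝ, ℝ)) ∈ S) (F : C(ℝ, ℝ))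
    (hF : ∀ t, F t = convolution φ s (ContinuousLinearMap.lsmul ℝ ℝ) volume (a * t + b)) :
    F ∈ S := by
  rw [← SetLike.mem_coe, ← hS.closure_eq]
  refine mem_closure_of_forall_isCompact fun K hK ε hε => ?_
  have : CompactSpace K := isCompact_iff_compactSpace.1 hK
  let r : C(ℝ, ℝ) →ₗ[ℝ] C(K, ℝ) :=
    { toFun := fun f => f.comp ⟨Subtype.val, continuous_subtype_val⟩
      map_add' := fun _ _ => rfl
      map_smul' := fun _ _ => rfl }
  -- Restriction to `K` makes the target a Banach space, where the convolution is the Bochner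
  -- integral of the curve `c` of scaled translates.
  let T : Submodule ℝ C(K, ℝ) := (S.map r).topologicalClosure
  have hTc : IsClosed (T : Set C(K, ℝ)) := Submodule.isClosed_topologicalClosure _
  let c : C(ℝ, C(K, ℝ)) :=
    ContinuousMap.curry ⟨fun p : ℝ × K => φ p.1 * s (a * p.2 + b - p.1), by fun_prop⟩
  have hcT : ∀ y, c y ∈ T := fun y => by
    refine Submodule.le_topologicalClosure _ ⟨φ y • ⟨fun t => s (a * t + b - y), by fun_prop⟩,
      S.smul_mem _ (hT y), ?_⟩
    rfl
  have hcs : HasCompactSupport c := by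
    refine hc.mono fun y hy => ?_
    contrapose! hy
    rw [Function.notMem_support] at hy ⊢
    ext x
    change φ y * s (a * x + b - y) = 0
    rw [hy, zero_mul]
  have hi : Integrable c volume := c.continuous.integrable_of_hasCompactSupport hcs
  have hev : ∀ x : K, (∫ y, c y) x = F x := fun x => by
    rw [hF]
    exact ((ContinuousMap.evalCLM ℝ x).integral_comp_comm hi).symm
  obtain ⟨g, ⟨g', hg', rfl⟩, hg⟩ :=
    Metric.mem_closure_iff.1 (integral_mem_of_isClosed hTc hi hcT) ε hε
  refine ⟨g', hg', fun x hx => ?_⟩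
  have h2 := (ContinuousMap.dist_lt_iff hε).1 hg ⟨x, hx⟩
  rw [hev, dist_comm, Real.dist_eq] at h2
  exact h2

/-- A smooth function with vanishing `k`-th derivative is a polynomial of degree less than `k`. -/
theorem exists_polynomial_of_iteratedDeriv_eq_zero (k : ℕ) (f : ℝ → ℝ) (hf : ContDiff ℝ k f)
    (h : ∀ t, iteratedDeriv k f t = 0) :
    ∃ p : Polynomial ℝ, p.degree < k ∧ ∀ t, f t = p.eval t := by
  induction k generalizing f with
  | zero => exact ⟨0, by simp, fun t => by simpa using h t⟩
  | succ k ih =>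
    have hd := (contDiff_succ_iff_deriv (n := k)).1 (by exact_mod_cast hf)
    obtain ⟨p, hp, hpe⟩ := ih (deriv f) hd.2.2 fun t => by rw [← iteratedDeriv_succ']; exact h t
    let q : Polynomial ℝ := ∑ i ∈ Finset.range k, Polynomial.monomial (i + 1) (p.coeff i / (i + 1))
    have hq : q.derivative = p := by
      ext m
      have hm : (m : ℝ) + 1 ≠ 0 := by positivity
      simp only [q, Polynomial.coeff_derivative, Polynomial.finsetSum_coeff,
        Polynomial.coeff_monomial, add_left_inj, Finset.sum_ite_eq', Finset.mem_range]
      split_ifs with h1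
      · field_simp
      · rw [zero_mul, Polynomial.coeff_eq_zero_of_degree_lt]
        exact hp.trans_le (by exact_mod_cast not_lt.1 h1)
    have hconst : ∀ t, f t - q.eval t = f 0 - q.eval 0 := fun t =>
      is_const_of_deriv_eq_zero (f := fun t => f t - q.eval t)
        (hd.1.sub q.differentiable) (fun t => by
          rw [deriv_fun_sub hd.1.differentiableAt q.differentiableAt, Polynomial.deriv, hq, hpe,
            sub_self]) t 0
    refine ⟨q + Polynomial.C (f 0 - q.eval 0), ?_, fun t => ?_⟩
    · refine (Polynomial.degree_add_le _ _).trans_lt (max_lt ?_ ?_)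
      · refine (Polynomial.degree_sum_le _ _).trans_lt ?_
        rw [Finset.sup_lt_iff (by exact_mod_cast WithBot.bot_lt_coe (k + 1))]
        intro i hi
        refine (Polynomial.degree_monomial_le _ _).trans_lt ?_
        have := Finset.mem_range.1 hi
        exact_mod_cast Nat.succ_lt_succ this
      · refine Polynomial.degree_C_le.trans_lt ?_
        exact_mod_cast Nat.succ_pos k
    · have := hconst t
      simp only [Polynomial.eval_add, Polynomial.eval_C]
      linarith

/-- A pointwise limit of polynomials of bounded degree is a polynomial. -/
theorem exists_polynomial_of_tendsto {ι : Type*} {l : Filter ι} [l.NeBot] (k : ℕ)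
    (p : ι → Polynomial ℝ) (hp : ∀ i, (p i).degree < k) (f : ℝ → ℝ)
    (h : ∀ t, Tendsto (fun i => (p i).eval t) l (𝓝 (f t))) :
    ∃ q : Polynomial ℝ, ∀ t, f t = q.eval t := by
  -- A polynomial of degree below `k` is determined by its values at `0, …, k - 1`, so convergence
  -- at these nodes identifies the limit.
  refine ⟨Lagrange.interpolate (Finset.range k) (fun i : ℕ => (i : ℝ)) (fun i => f i),
    fun t => ?_⟩
  have h1 : ∀ i, (p i).eval t
      = ∑ j ∈ Finset.range k, (p i).eval (j : ℝ) *
        (Lagrange.basis (Finset.range k) (fun i : ℕ => (i : ℝ)) j).eval t := fun i => by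
    conv_lhs => rw [Lagrange.eq_interpolate (s := Finset.range k) (v := fun i : ℕ => (i : ℝ))
      (f := p i) (Nat.cast_injective.injOn) (by simpa using hp i)]
    simp [Lagrange.interpolate_apply, Polynomial.eval_finsetSum]
  refine tendsto_nhds_unique (h t) ?_
  simp only [h1, Lagrange.interpolate_apply, Polynomial.eval_finsetSum, Polynomial.eval_mul,
    Polynomial.eval_C]
  exact tendsto_finsetSum _ fun j _ => (h j).mul_const _

/-- The monomial `t ^ k` as a continuous function. -/
def monomialMap (k : ℕ) : C(ℝ, ℝ) := ⟨fun t => t ^ k, by fun_prop⟩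

/-- If a closed subspace contains the dilates of `g` around `b` and the monomials of degree less
than `k`, and if the `k`-th derivative of `g` at `b` does not vanish, it contains `t ^ k`. -/
theorem monomialMap_mem_of_iteratedDeriv_ne_zero {S : Submodule ℝ C(ℝ, ℝ)}
    (hS : IsClosed (S : Set C(ℝ, ℝ))) {k : ℕ} {g : ℝ → ℝ} (hg : ContDiff ℝ k g) (b : ℝ)
    (hT : ∀ a, (⟨fun t => g (a * t + b), by have := hg.continuous; fun_prop⟩ : C(ℝ, ℝ)) ∈ S)
    (hk : ∀ j < k, monomialMap j ∈ S) (hb : iteratedDeriv k g b ≠ 0) : monomialMap k ∈ S := by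
  set d := iteratedDeriv k g b / k.factorial with hd
  have hd0 : d ≠ 0 := div_ne_zero hb (by positivity)
  suffices h : d • monomialMap k ∈ S by
    have := S.smul_mem d⁻¹ h
    rwa [smul_smul, inv_mul_cancel₀ hd0, one_smul] at this
  rw [← SetLike.mem_coe, ← hS.closure_eq]
  refine mem_closure_of_forall_isCompact fun K hK ε hε => ?_
  obtain ⟨R, hR0, hR⟩ : ∃ R > 0, ∀ x ∈ K, |x| ≤ R := by
    obtain ⟨R, hR⟩ := hK.isBounded.exists_norm_le
    exact ⟨max R 1, by positivity, fun x hx => (hR x hx).trans (le_max_left _ _)⟩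
  -- Taylor tolerance chosen so that, after division by `a ^ k`, the error for `|x| ≤ R` is at most
  -- `ε / 2`.
  have hc : 0 < ε / (2 * R ^ k) := by positivity
  obtain ⟨δ, hδ, hδ'⟩ := Metric.eventually_nhds_iff.1 ((taylor_isLittleO_univ hg (x₀ := b)).def hc)
  set a := δ / (2 * R) with ha
  have ha0 : 0 < a := by positivity
  -- Remove the Taylor terms of order below `k` from the dilate and rescale: what remains is `d * t
  -- ^ k` up to the Taylor error.
  refine ⟨(a ^ k)⁻¹ • ((⟨fun t => g (a * t + b), by have := hg.continuous; fun_prop⟩ : C(ℝ, ℝ)) -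
    ∑ j ∈ Finset.range k, (iteratedDeriv j g b / j.factorial * a ^ j) • monomialMap j),
    S.smul_mem _ (S.sub_mem (hT a) (S.sum_mem fun j hj =>
      S.smul_mem _ (hk j (Finset.mem_range.1 hj)))), fun x hx => ?_⟩
  have h1 : |a * x| < δ := by
    rw [abs_mul, abs_of_pos ha0]
    calc a * |x| ≤ a * R := by gcongr; exact hR x hx
      _ = δ / 2 := by rw [ha]; field_simp
      _ < δ := half_lt_self hδ
  have h2 := @hδ' (a * x + b) (by rwa [Real.dist_eq, add_sub_cancel_right])
  simp only [taylor_within_apply, iteratedDerivWithin_univ, add_sub_cancel_right,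
    Finset.sum_range_succ, smul_eq_mul] at h2
  have hak : 0 < a ^ k := by positivity
  have h3 : ((a ^ k)⁻¹ • ((⟨fun t => g (a * t + b), by have := hg.continuous; fun_prop⟩ : C(ℝ, ℝ)) -
      ∑ j ∈ Finset.range k, (iteratedDeriv j g b / j.factorial * a ^ j) • monomialMap j)) x
      - (d • monomialMap k) x = (a ^ k)⁻¹ * (g (a * x + b) -
      (∑ j ∈ Finset.range k, (j.factorial : ℝ)⁻¹ * (a * x) ^ j * iteratedDeriv j g b
        + (k.factorial : ℝ)⁻¹ * (a * x) ^ k * iteratedDeriv k g b)) := by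
    simp only [ContinuousMap.smul_apply, ContinuousMap.sub_apply, ContinuousMap.coe_mk,
      ContinuousMap.coe_sum, Finset.sum_apply, ContinuousMap.coe_smul, Pi.smul_apply, smul_eq_mul,
      monomialMap, hd]
    have h4 : ∀ j, iteratedDeriv j g b / j.factorial * a ^ j * x ^ j =
        (j.factorial : ℝ)⁻¹ * (a * x) ^ j * iteratedDeriv j g b := fun j => by
      rw [mul_pow]; ring
    simp only [h4]
    rw [← sub_sub, mul_sub _ _ ((k.factorial : ℝ)⁻¹ * _ * _), mul_pow a x k]
    congr 1
    field_simp
  rw [h3, abs_mul, abs_of_pos (inv_pos.2 hak)]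
  rw [Real.norm_eq_abs, Real.norm_eq_abs, abs_pow, abs_mul, abs_of_pos ha0] at h2
  calc _ ≤ (a ^ k)⁻¹ * (ε / (2 * R ^ k) * (a ^ k * R ^ k)) := by
        gcongr
        refine h2.trans ?_
        rw [mul_pow]
        gcongr
        exact hR x hx
    _ = ε / 2 := by field_simp
    _ < ε := half_lt_self hε

/-- A closed subspace of `C(ℝ, ℝ)` that contains all dilated translates of a continuous function
that is not a polynomial is the whole space. -/
theorem eq_top_of_forall_dilate_mem {S : Submodule ℝ C(ℝ, ℝ)} (hS : IsClosed (S : Set C(ℝ, ℝ)))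
    {s : ℝ → ℝ} (hs : Continuous s) (hpoly : ¬ ∃ p : Polynomial ℝ, ∀ t, s t = p.eval t)
    (hT : ∀ a b, (⟨fun t => s (a * t + b), by fun_prop⟩ : C(ℝ, ℝ)) ∈ S) : S = ⊤ := by
  have hmono : ∀ k, monomialMap k ∈ S := by
    -- Let `t ^ k` be the least missing power. Mollifications of `s` are smooth and their dilates
    -- stay in `S`, so their `k`-th derivatives vanish everywhere. They are then polynomials of
    -- degree below `k`, and so is their limit `s`, up to the degree bound.
    by_contra! hne
    classical
    obtain ⟨k, hk, hmin⟩ : ∃ k, monomialMap k ∉ S ∧ ∀ j < k, monomialMap j ∈ S :=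
      ⟨Nat.find hne, Nat.find_spec hne, fun j hj => not_not.1 (Nat.find_min hne hj)⟩
    refine hpoly ?_
    let φ : ℕ → ContDiffBump (0 : ℝ) := fun i =>
      ⟨1 / ((i : ℝ) + 1) / 2, 1 / ((i : ℝ) + 1), by positivity, half_lt_self (by positivity)⟩
    have hφ : Tendsto (fun i => (φ i).rOut) atTop (𝓝 0) := tendsto_one_div_add_atTop_nhds_zero_nat
    let g : ℕ → ℝ → ℝ := fun i =>
      convolution ((φ i).normed volume) s (ContinuousLinearMap.lsmul ℝ ℝ) volume
    have hgc : ∀ i, ContDiff ℝ k (g i) := fun i =>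
      (φ i).hasCompactSupport_normed.contDiff_convolution_left (n := k) _ (φ i).contDiff_normed
        hs.locallyIntegrable
    have hgd : ∀ i t, iteratedDeriv k (g i) t = 0 := fun i t => by
      by_contra h0
      refine hk (monomialMap_mem_of_iteratedDeriv_ne_zero hS (hgc i) t (fun a => ?_) hmin h0)
      refine convolution_mem_of_translates hS hs ((φ i).contDiff_normed (n := 0)).continuous
        (φ i).hasCompactSupport_normed a t (fun y => ?_) _ fun _ => rfl
      simpa only [add_sub_assoc] using hT a (t - y)
    choose p hp hpe using fun i =>
      exists_polynomial_of_iteratedDeriv_eq_zero k (g i) (hgc i) (hgd i)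
    refine exists_polynomial_of_tendsto (l := atTop) k p hp s fun t => ?_
    simp only [← hpe]
    exact ContDiffBump.convolution_tendsto_right_of_continuous hφ hs t
  let A : Subalgebra ℝ C(ℝ, ℝ) := (Polynomial.toContinuousMapAlgHom (R := ℝ)).range
  have hA : A.SeparatesPoints := fun x y hxy =>
    ⟨_, ⟨_, ⟨Polynomial.X, rfl⟩, rfl⟩, by simpa using hxy⟩
  refine eq_top_iff.2 fun f _ => ?_
  rw [← SetLike.mem_coe, ← hS.closure_eq]
  refine closure_mono ?_ (mem_closure_of_separatesPoints hA f)
  rintro _ ⟨p, rfl⟩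
  induction p using Polynomial.induction_on' with
  | add p q hp hq => rw [map_add]; exact S.add_mem hp hq
  | monomial k c =>
    have h : Polynomial.toContinuousMapAlgHom (Polynomial.monomial k c) = c • monomialMap k := by
      ext t
      simp [monomialMap]
    exact h ▸ S.smul_mem c (hmono k)

/-- Ridge functions are dense: a closed subspace of `C(ℝ ^ ι, ℝ)` that contains all `s ∘ ℓ` with
`ℓ` affine is the whole space. -/
theorem eq_top_of_forall_ridge_mem {ι : Type*} [Finite ι] {S : Submodule ℝ C(ι → ℝ, ℝ)}
    (hS : IsClosed (S : Set C(ι → ℝ, ℝ)))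
    {s : ℝ → ℝ} (hs : Continuous s) (hpoly : ¬ ∃ p : Polynomial ℝ, ∀ t, s t = p.eval t)
    (hT : ∀ F : C(ι → ℝ, ℝ), ∀ ℓ : (ι → ℝ) →ᵃ[ℝ] ℝ, (∀ x, F x = s (ℓ x)) → F ∈ S) : S = ⊤ := by
  have hridge : ∀ (w : (ι → ℝ) →L[ℝ] ℝ) (f : C(ℝ, ℝ)), f.comp (w : C(ι → ℝ, ℝ)) ∈ S := fun w f => by
    let r : C(ℝ, ℝ) →ₗ[ℝ] C(ι → ℝ, ℝ) :=
      { toFun := fun f => f.comp (w : C(ι → ℝ, ℝ))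
        map_add' := fun _ _ => rfl
        map_smul' := fun _ _ => rfl }
    have hr : Continuous r := ContinuousMap.continuous_precomp _
    -- Along a fixed linear form the problem is one-dimensional.
    have h : S.comap r = ⊤ := by
      refine eq_top_of_forall_dilate_mem (hS.preimage hr) hs hpoly fun a b => ?_
      refine hT _ (a • w.toLinearMap.toAffineMap + AffineMap.const ℝ _ b) fun x => ?_
      simp [r]
    exact (h ▸ Submodule.mem_top : f ∈ S.comap r)
  let e : ((ι → ℝ) →L[ℝ] ℝ) → C(ι → ℝ, ℝ) := fun w =>
    (⟨Real.exp, Real.continuous_exp⟩ : C(ℝ, ℝ)).comp (w : C(ι → ℝ, ℝ))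
  -- Since the exponentials are closed under multiplication, the algebra they generate is just their
  -- linear span.
  let M : Submonoid C(ι → ℝ, ℝ) :=
    { carrier := Set.range e
      one_mem' := ⟨0, by ext; simp [e]⟩
      mul_mem' := by
        rintro _ _ ⟨v, rfl⟩ ⟨w, rfl⟩
        exact ⟨v + w, by ext; simp [e, Real.exp_add]⟩ }
  let A : Subalgebra ℝ C(ι → ℝ, ℝ) := Algebra.adjoin ℝ (M : Set C(ι → ℝ, ℝ))
  have hA : A.SeparatesPoints := fun x y hxy => by
    obtain ⟨i, hi⟩ := Function.ne_iff.1 hxy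
    refine ⟨_, ⟨_, Algebra.subset_adjoin ⟨ContinuousLinearMap.proj i, rfl⟩, rfl⟩, ?_⟩
    simpa [e] using hi
  refine eq_top_iff.2 fun f _ => ?_
  rw [← SetLike.mem_coe, ← hS.closure_eq]
  refine closure_mono ?_ (mem_closure_of_separatesPoints hA f)
  intro g hg
  have hg' : g ∈ Submodule.span ℝ (M : Set C(ι → ℝ, ℝ)) := by
    have h := Algebra.adjoin_eq_span ℝ (M : Set C(ι → ℝ, ℝ))
    rw [Submonoid.closure_eq] at h
    rw [← h]
    exact hg
  refine Submodule.span_le.2 ?_ hg'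
  rintro _ ⟨w, rfl⟩
  exact hridge w _

end UniversalApproximation

/-! ### Networks as a linear space, and conditions inherited by the closure -/

section Networks

theorem affineMap_sum_apply {P Q ι : Type*} [AddCommGroup P] [Module ℝ P]
    [AddCommGroup Q] [Module ℝ Q] (s : Finset ι)
    (f : ι → (P →ᵃ[ℝ] Q)) (x : P) : (∑ i ∈ s, f i) x = ∑ i ∈ s, f i x := by
  classical
  induction s using Finset.induction_on with
  | empty => simp
  | insert i s hi ih => simp [Finset.sum_insert hi, ih]

variable {V Y Z : Type*} [AddCommGroup V] [Module ℝ V] [TopologicalSpace V]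
  [AddCommGroup Z] [Module ℝ Z] [TopologicalSpace Z] {σ : ℝ → ℝ}
  {M M' : Submodule ℝ (V →ᵃ[ℝ] (Y → ℝ))} {N N' : Submodule ℝ ((Y → ℝ) →ᵃ[ℝ] Z)}

theorem mem_networks_iff {F : C(V, Z)} :
    F ∈ networks σ M N ↔ ∃ (h : ℕ) (f : Fin h → (V →ᵃ[ℝ] (Y → ℝ)))
      (g : Fin h → ((Y → ℝ) →ᵃ[ℝ] Z)), (∀ j, f j ∈ M) ∧ (∀ j, g j ∈ N) ∧
      ∀ v, F v = ∑ j, g j (pointwise σ (f j v)) := by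
  constructor
  · rintro ⟨h, φ, ⟨g, hg, hφ⟩, η, ⟨f, hf, hη⟩, hF⟩
    refine ⟨h, f, g, hf, hg, fun v => ?_⟩
    rw [hF, Function.comp_apply, Function.comp_apply, hφ]
    simp only [pointwise, hη]
    rfl
  · rintro ⟨h, f, g, hf, hg, hF⟩
    refine ⟨h, ∑ j, (g j).comp (LinearMap.funLeft ℝ ℝ (fun y => (y, j))).toAffineMap,
      ⟨g, hg, fun w => ?_⟩,
      AffineMap.pi fun p : Y × Fin h =>
        (LinearMap.proj (R := ℝ) (φ := fun _ : Y => ℝ) p.1).toAffineMap.comp (f p.2),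
      ⟨f, hf, fun v y j => rfl⟩, ?_⟩
    · rw [affineMap_sum_apply]
      rfl
    · ext v
      rw [hF, Function.comp_apply, Function.comp_apply, affineMap_sum_apply]
      rfl

theorem mem_networks_of_eq {F : C(V, Z)} {f : V →ᵃ[ℝ] (Y → ℝ)} {g : (Y → ℝ) →ᵃ[ℝ] Z}
    (hf : f ∈ M) (hg : g ∈ N) (h : ∀ v, F v = g (pointwise σ (f v))) : F ∈ networks σ M N :=
  mem_networks_iff.2 ⟨1, fun _ => f, fun _ => g, fun _ => hf, fun _ => hg, fun v => by simp [h]⟩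

theorem networks_mono (hM : M ≤ M') (hN : N ≤ N') : networks σ M N ⊆ networks σ M' N' := by
  intro F hF
  obtain ⟨h, f, g, hf, hg, hF⟩ := mem_networks_iff.1 hF
  exact mem_networks_iff.2 ⟨h, f, g, fun j => hM (hf j), fun j => hN (hg j), hF⟩

theorem universalityClass_mono (hM : M ≤ M') (hN : N ≤ N') :
    universalityClass σ M N ⊆ universalityClass σ M' N' :=
  closure_mono (networks_mono hM hN)

/-- The networks of all widths form a linear subspace of `C(V, Z)`. -/
def networksSubmodule [IsTopologicalAddGroup Z] [ContinuousConstSMul ℝ Z] (σ : ℝ → ℝ)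
    (M : Submodule ℝ (V →ᵃ[ℝ] (Y → ℝ))) (N : Submodule ℝ ((Y → ℝ) →ᵃ[ℝ] Z)) :
    Submodule ℝ C(V, Z) where
  carrier := networks σ M N
  zero_mem' := mem_networks_iff.2 ⟨0, nofun, nofun, nofun, nofun, fun v => by simp⟩
  add_mem' := by
    intro F F' hF hF'
    obtain ⟨h, f, g, hf, hg, hF⟩ := mem_networks_iff.1 hF
    obtain ⟨h', f', g', hf', hg', hF'⟩ := mem_networks_iff.1 hF'
    refine mem_networks_iff.2 ⟨h + h', Fin.append f f', Fin.append g g', fun j => ?_,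
      fun j => ?_, fun v => ?_⟩
    · refine Fin.addCases (fun i => ?_) (fun i => ?_) j
      · simpa using hf i
      · simpa using hf' i
    · refine Fin.addCases (fun i => ?_) (fun i => ?_) j
      · simpa using hg i
      · simpa using hg' i
    · simp [Fin.sum_univ_add, hF, hF']
  smul_mem' := by
    intro c F hF
    obtain ⟨h, f, g, hf, hg, hF⟩ := mem_networks_iff.1 hF
    exact mem_networks_iff.2 ⟨h, f, fun j => c • g j, hf, fun j => N.smul_mem c (hg j),
      fun v => by simp [hF, Finset.smul_sum]⟩

/-- A combination of point evaluations with total weight zero that kills the activated first layer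
kills the whole universality class. -/
theorem sum_smul_eq_zero_of_mem_universalityClass [IsTopologicalAddGroup Z]
    [ContinuousConstSMul ℝ Z] [T2Space Z] {ι : Type*} [Fintype ι] (w : ι → ℝ) (p : ι → V)
    (hw : ∑ k, w k = 0) (hM : ∀ f ∈ M, ∑ k, w k • pointwise σ (f (p k)) = 0)
    {F : C(V, Z)} (hF : F ∈ universalityClass σ M N) : ∑ k, w k • F (p k) = 0 := by
  have hc : IsClosed {F : C(V, Z) | ∑ k, w k • F (p k) = 0} := by
    refine isClosed_eq ?_ continuous_const
    exact continuous_finsetSum _ fun k _ => (continuous_eval_const _).const_smul _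
  refine closure_minimal ?_ hc hF
  intro F hF
  obtain ⟨h, f, g, hf, -, hF⟩ := mem_networks_iff.1 hF
  simp only [Set.mem_ofPred_eq, hF, Finset.smul_sum]
  rw [Finset.sum_comm]
  refine Finset.sum_eq_zero fun j _ => ?_
  -- The constant part of the affine map `g j` drops out because the weights sum to zero.
  have h1 : ∀ u, g j u = (g j).linear u + g j 0 := fun u => by
    simpa using (g j).map_vadd 0 u
  simp only [h1 (pointwise _ _), smul_add, Finset.sum_add_distrib, ← Finset.sum_smul, hw,
    zero_smul, add_zero, ← map_smul, ← map_sum]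
  rw [hM _ (hf j), map_zero]

variable {G : Type*} [Group G] [MulAction G Y] {ρ : Representation ℝ G V}
  {τ : Representation ℝ G Z}

/-- The activation commutes with permutations of coordinates, and equivariance at a given `g` and
`v` is a closed condition. -/
theorem map_rep_of_mem_universalityClass [T2Space Z] (hτ : ∀ g, Continuous (τ g))
    (hM : M ≤ equivAff ρ (permRep G Y)) (hN : N ≤ equivAff (permRep G Y) τ) {F : C(V, Z)}
    (hF : F ∈ universalityClass σ M N) (g : G) (v : V) : F (ρ g v) = τ g (F v) := by
  have hc : IsClosed {F : C(V, Z) | F (ρ g v) = τ g (F v)} :=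
    isClosed_eq (continuous_eval_const _)
      ((hτ g).comp (continuous_eval_const _))
  refine closure_minimal ?_ hc hF
  intro F hF
  obtain ⟨h, f, g', hf, hg, hF⟩ := mem_networks_iff.1 hF
  simp only [Set.mem_ofPred_eq, hF, map_sum]
  refine Finset.sum_congr rfl fun j _ => ?_
  rw [← hN (hg j), hM (hf j)]
  rfl

end Networks

/-! ### Equivariant universality of the regular hidden representation -/

section Regular

/-- Precomposition with a continuous map, as a continuous linear map. -/
def precompCLM {X X' : Type*} (Z : Type*) [TopologicalSpace X] [TopologicalSpace X']
    [AddCommGroup Z] [Module ℝ Z] [TopologicalSpace Z] [IsTopologicalAddGroup Z]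
    [ContinuousConstSMul ℝ Z] (r : C(X, X')) : C(X', Z) →L[ℝ] C(X, Z) where
  toFun F := F.comp r
  map_add' _ _ := rfl
  map_smul' _ _ := rfl
  cont := ContinuousMap.continuous_precomp r

variable {ι Z : Type*} [Finite ι] [AddCommGroup Z] [Module ℝ Z] [TopologicalSpace Z]
  [IsTopologicalAddGroup Z] [ContinuousSMul ℝ Z] [T2Space Z] [FiniteDimensional ℝ Z]
  {G : Type*} [Group G] [Fintype G]

/-- Averaging over a finite group, as a continuous projection onto the equivariant maps. -/
noncomputable def symmetrize (ρ : Representation ℝ G (ι → ℝ)) (τ : Representation ℝ G Z) :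
    C(ι → ℝ, Z) →L[ℝ] C(ι → ℝ, Z) :=
  (Fintype.card G : ℝ)⁻¹ • ∑ h : G,
    ((τ h).toContinuousLinearMap.compLeftContinuous ℝ (ι → ℝ)).comp
      (precompCLM Z ⟨ρ h⁻¹, (ρ h⁻¹).continuous_of_finiteDimensional⟩)

theorem symmetrize_apply (ρ : Representation ℝ G (ι → ℝ)) (τ : Representation ℝ G Z)
    (F : C(ι → ℝ, Z)) (v : ι → ℝ) :
    symmetrize ρ τ F v = (Fintype.card G : ℝ)⁻¹ • ∑ h : G, τ h (F (ρ h⁻¹ v)) := by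
  simp [symmetrize, precompCLM]

/-- Shallow networks with a regular hidden representation approximate all continuous equivariant
maps. -/
theorem mem_universalityClass_of_map_rep {σ : ℝ → ℝ} (hσ : Continuous σ)
    (hpoly : ¬ ∃ p : Polynomial ℝ, ∀ t, σ t = p.eval t)
    (ρ : Representation ℝ G (ι → ℝ)) (τ : Representation ℝ G Z) (F : C(ι → ℝ, Z))
    (hF : ∀ g v, F (ρ g v) = τ g (F v)) :
    F ∈ universalityClass σ (equivAff ρ (permRep G G)) (equivAff (permRep G G) τ) := by
  -- `S` consists of the maps whose symmetrization is a limit of networks; it is closed, so ridge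
  -- functions times vectors suffice to fill it.
  let S : Submodule ℝ C(ι → ℝ, Z) := (networksSubmodule σ (equivAff ρ (permRep G G))
    (equivAff (permRep G G) τ)).topologicalClosure.comap (symmetrize ρ τ).toLinearMap
  have hS : IsClosed (S : Set C(ι → ℝ, Z)) :=
    (Submodule.isClosed_topologicalClosure _).preimage (symmetrize ρ τ).continuous
  have hz : ∀ (z : Z) (f : C(ι → ℝ, ℝ)),
      (ContinuousLinearMap.toSpanSingleton ℝ z).compLeftContinuous ℝ (ι → ℝ) f ∈ S := by
    intro z f
    let L := (ContinuousLinearMap.toSpanSingleton ℝ z).compLeftContinuous ℝ (ι → ℝ)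
    have h : S.comap L.toLinearMap = ⊤ := by
      refine eq_top_of_forall_ridge_mem (hS.preimage L.continuous) hσ hpoly fun F ℓ hFℓ => ?_
      -- The symmetrization of `σ(ℓ v) • z` is a single network: hidden unit `h` computes `ℓ (ρ h⁻¹
      -- v)`, and the output layer weights it by `τ h z / |G|`.
      refine Submodule.le_topologicalClosure _ (mem_networks_of_eq
        (f := AffineMap.pi fun h => ℓ.comp (ρ h⁻¹).toAffineMap)
        (g := (∑ h : G, (LinearMap.toSpanSingleton ℝ Z ((Fintype.card G : ℝ)⁻¹ • τ h z)).comp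
          (LinearMap.proj (R := ℝ) (φ := fun _ : G => ℝ) h)).toAffineMap) ?_ ?_ ?_)
      · intro k v
        ext h
        change ℓ (ρ h⁻¹ (ρ k v)) = ℓ (ρ (k⁻¹ * h)⁻¹ v)
        rw [mul_inv_rev, inv_inv, map_mul]
        rfl
      · intro k w
        simp only [LinearMap.coe_toAffineMap, LinearMap.sum_apply, LinearMap.comp_apply,
          LinearMap.proj_apply, LinearMap.toSpanSingleton_apply, map_sum, map_smul]
        rw [← Equiv.sum_comp (Equiv.mulLeft k)]
        refine Finset.sum_congr rfl fun h _ => ?_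
        change w (k⁻¹ * (k * h)) • (Fintype.card G : ℝ)⁻¹ • τ (k * h) z = _
        rw [inv_mul_cancel_left, map_mul]
        rfl
      · intro v
        change symmetrize ρ τ (L F) v = _
        rw [symmetrize_apply, Finset.smul_sum]
        simp [L, hFℓ, pointwise, smul_comm (σ _)]
    exact (h ▸ Submodule.mem_top : f ∈ S.comap L.toLinearMap)
  let b := Module.finBasis ℝ Z
  have hFS : F ∈ S := by
    have : F = ∑ i, (ContinuousLinearMap.toSpanSingleton ℝ (b i)).compLeftContinuous ℝ (ι → ℝ)
        ((b.coord i).toContinuousLinearMap.compLeftContinuous ℝ (ι → ℝ) F) := by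
      ext v
      simp
    rw [this]
    exact S.sum_mem fun i _ => hz _ _
  have hfix : symmetrize ρ τ F = F := by
    ext v
    have : ∀ h : G, τ h (F (ρ h⁻¹ v)) = F v := fun h => by
      rw [← hF, ← Module.End.mul_apply, ← map_mul, mul_inv_cancel, map_one]
      rfl
    simp [symmetrize_apply, this, ← Nat.cast_smul_eq_nsmul ℝ, smul_smul]
  rw [← hfix]
  exact hFS

end Regular

/-! ### Explicit form of the equivariant layers -/

section Layers

variable {n : ℕ}

theorem permRep_apply {G X : Type*} [Group G] [MulAction G X] (g : G) (v : X → ℝ) (x : X) :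
    permRep G X g v x = v (g⁻¹ • x) := rfl

theorem permRep_single {G X : Type*} [Group G] [MulAction G X] [DecidableEq X] (g : G) (x : X)
    (c : ℝ) : permRep G X g (Pi.single x c) = Pi.single (g • x) c := by
  ext y
  simp only [permRep_apply, Pi.single_apply, inv_smul_eq_iff]

theorem sum_permRep {G X : Type*} [Group G] [MulAction G X] [Fintype X] (g : G) (v : X → ℝ) :
    ∑ x, permRep G X g v x = ∑ x, v x :=
  Equiv.sum_comp (MulAction.toPerm g⁻¹) v

theorem affineMap_apply_eq_sum {ι Z : Type*} [Fintype ι] [DecidableEq ι] [AddCommGroup Z]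
    [Module ℝ Z] (f : (ι → ℝ) →ᵃ[ℝ] Z) (v : ι → ℝ) :
    f v = ∑ j, v j • (f (Pi.single j 1) - f 0) + f 0 := by
  have h1 : ∀ u, f u = f.linear u + f 0 := fun u => by simpa using f.map_vadd 0 u
  conv_lhs => rw [h1, ← Finset.univ_sum_single v, map_sum]
  congr 1
  refine Finset.sum_congr rfl fun j _ => ?_
  rw [h1 (Pi.single j 1), add_sub_cancel_right, ← map_smul, ← Pi.single_smul, smul_eq_mul, mul_one]

theorem mem_symAff_iff {f : (Fin n → ℝ) →ᵃ[ℝ] (Fin n → ℝ)} :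
    f ∈ symAff n (Fin n) (Fin n) ↔
      ∀ g v, f (permRep (SymGroup n) (Fin n) g v) = permRep (SymGroup n) (Fin n) g (f v) :=
  Iff.rfl

/-- Coordinates of an equivariant affine self-map of `ℝⁿ`. -/
theorem exists_apply_eq_of_mem_symAff {f : (Fin n → ℝ) →ᵃ[ℝ] (Fin n → ℝ)}
    (hf : f ∈ symAff n (Fin n) (Fin n)) (i : Fin n) :
    ∃ a b c : ℝ, ∀ v, f v i = a * v i + b * ∑ j, v j + c := by
  set m : Fin n → ℝ := fun j => f (Pi.single j 1) i - f 0 i with hm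
  obtain ⟨b, hb⟩ : ∃ b, ∀ j, j ≠ i → m j = b := by
    by_cases h : ∃ j, j ≠ i
    · obtain ⟨k, hk⟩ := h
      refine ⟨m k, fun j hj => ?_⟩
      -- The transposition of `k` and `j` fixes `i`, so all off-diagonal entries of row `i` agree.
      have h1 := mem_symAff_iff.1 hf (Equiv.swap k j) (Pi.single k 1)
      rw [permRep_single, Equiv.Perm.smul_def, Equiv.swap_apply_left] at h1
      have h2 := congrFun h1 i
      rw [permRep_apply, Equiv.swap_inv, Equiv.Perm.smul_def,
        Equiv.swap_apply_of_ne_of_ne hk.symm hj.symm] at h2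
      simp only [hm, h2]
    · push Not at h
      exact ⟨0, fun j hj => absurd (h j) hj⟩
  refine ⟨m i - b, b, f 0 i, fun v => ?_⟩
  have h1 := congrFun (affineMap_apply_eq_sum f v) i
  have h2 : ∀ j, v j * m j = v j * b + if j = i then v i * (m i - b) else 0 := fun j => by
    split_ifs with h
    · rw [h]; ring
    · rw [hb j h, add_zero]
  simp only [Pi.add_apply, Finset.sum_apply, Pi.smul_apply, Pi.sub_apply, smul_eq_mul] at h1
  rw [h1, Finset.sum_congr rfl fun j _ => h2 j, Finset.sum_add_distrib, ← Finset.sum_mul]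
  simp
  ring

/-- The affine map `v ↦ a v + b 𝟙`. -/
def scaleShift (n : ℕ) (a b : ℝ) : (Fin n → ℝ) →ᵃ[ℝ] (Fin n → ℝ) :=
  a • AffineMap.id ℝ (Fin n → ℝ) + AffineMap.const ℝ _ fun _ => b

@[simp] theorem scaleShift_apply (a b : ℝ) (v : Fin n → ℝ) (i : Fin n) :
    scaleShift n a b v i = a * v i + b := rfl

theorem scaleShift_mem_convLayer (hn : 0 < n) {k : ℕ} (hk : 1 ≤ k) (a b : ℝ) :
    scaleShift n a b ∈ convLayer n k := by
  have : NeZero n := ⟨hn.ne'⟩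
  refine ⟨Pi.single 0 a, b, fun v => ?_⟩
  rw [Finset.sum_eq_single (0 : Fin n)]
  · rw [Matrix.circulant_single_one, Matrix.one_mulVec, Pi.single_eq_same]
    ext i
    simp
  · intro j _ hj
    rw [Pi.single_eq_of_ne hj, zero_smul]
  · intro h
    refine absurd ?_ h
    exact Finset.mem_filter.2 ⟨Finset.mem_univ _, hk⟩

/-- Only the index `0` survives in a filter of width 1, and its circulant matrix is the identity. -/
theorem eq_scaleShift_of_mem_convLayer (hn : 0 < n) {f : (Fin n → ℝ) →ᵃ[ℝ] (Fin n → ℝ)}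
    (hf : f ∈ convLayer n 1) : ∃ a b, f = scaleShift n a b := by
  have : NeZero n := ⟨hn.ne'⟩
  obtain ⟨x, y, h⟩ := hf
  refine ⟨x 0, y, AffineMap.ext fun v => ?_⟩
  rw [h, Finset.sum_eq_single (0 : Fin n)]
  · rw [Matrix.circulant_single_one, Matrix.one_mulVec]
    ext i
    simp
  · intro j hj hj0
    refine absurd ?_ hj0
    have := (Finset.mem_filter.1 hj).2
    exact Fin.ext (by simpa using this)
  · intro h
    refine absurd ?_ h
    simp

theorem convLayer_one_le_symAff (hn : 0 < n) : convLayer n 1 ≤ symAff n (Fin n) (Fin n) := by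
  intro f hf
  obtain ⟨a, b, rfl⟩ := eq_scaleShift_of_mem_convLayer hn hf
  exact mem_symAff_iff.2 fun g v => rfl

theorem exists_finRotate_zpow_eq (m : ℕ) (j k : Fin (m + 2)) :
    ∃ i : ℤ, (finRotate (m + 2) ^ i) j = k := by
  have h : ∀ j, finRotate (m + 2) j ≠ j := fun j => by simp
  exact isCycle_finRotate.exists_zpow_eq (h j) (h k)

/-- Cyclic shifts are already transitive on `[n]`, so the linear coefficients are all equal and the
map depends only on the coordinate sum. -/
theorem invLayer_le_symInv (hn : 1 < n) : invLayer n ≤ symInv n (Fin n) := by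
  obtain ⟨m, rfl⟩ : ∃ m, n = m + 2 := ⟨n - 2, by omega⟩
  intro f hf
  have hc : ∀ j, f (Pi.single j 1) = f (Pi.single 0 1) := fun j => by
    obtain ⟨i, hi⟩ := exists_finRotate_zpow_eq m 0 j
    have h := hf ⟨finRotate (m + 2) ^ i, i, rfl⟩ (Pi.single 0 1)
    rw [permRep_single] at h
    rw [← hi]
    exact h
  intro g v
  rw [affineMap_apply_eq_sum f, affineMap_apply_eq_sum f v]
  simp only [hc, ← Finset.sum_smul, sum_permRep]
  rfl

variable {Z : Type*} [AddCommGroup Z] [Module ℝ Z]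

/-- The linear layer `w ↦ (∑ i, w i) • z`. -/
noncomputable def sumLayer (n : ℕ) (z : Z) : (Fin n → ℝ) →ᵃ[ℝ] Z :=
  (∑ i, (LinearMap.toSpanSingleton ℝ Z z).comp
    (LinearMap.proj (R := ℝ) (φ := fun _ : Fin n => ℝ) i)).toAffineMap

@[simp] theorem sumLayer_apply (z : Z) (w : Fin n → ℝ) : sumLayer n z w = (∑ i, w i) • z := by
  simp [sumLayer, Finset.sum_smul]

theorem sumLayer_mem_equivAff {G : Type*} [Group G] [MulAction G (Fin n)]
    {τ : Representation ℝ G Z} {z : Z} (hz : ∀ g, τ g z = z) :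
    sumLayer n z ∈ equivAff (permRep G (Fin n)) τ := fun g v => by
  rw [sumLayer_apply, sum_permRep, sumLayer_apply, map_smul, hz]

end Layers

/-! ### Separation relations -/

section Separation

theorem sepRel_anti {X Z : Type*} [TopologicalSpace X] [TopologicalSpace Z] {A B : Set C(X, Z)}
    (h : A ⊆ B) : sepRel B ⊆ sepRel A := fun _ hp f hf => hp f (h hf)

theorem sepRel_closure {X Z : Type*} [TopologicalSpace X] [TopologicalSpace Z] [T2Space Z]
    (A : Set C(X, Z)) : sepRel (closure A) = sepRel A := by
  refine Set.Subset.antisymm (sepRel_anti subset_closure) fun p hp f hf => ?_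
  have hc : IsClosed {f : C(X, Z) | f p.1 = f p.2} :=
    isClosed_eq (continuous_eval_const _) (continuous_eval_const _)
  exact closure_minimal (fun f hf => hp f hf) hc hf

theorem sepRel_universalityClass {V Y Z : Type*} [AddCommGroup V] [Module ℝ V] [TopologicalSpace V]
    [AddCommGroup Z] [Module ℝ Z] [TopologicalSpace Z] [T2Space Z] (σ : ℝ → ℝ)
    (M : Submodule ℝ (V →ᵃ[ℝ] (Y → ℝ))) (N : Submodule ℝ ((Y → ℝ) →ᵃ[ℝ] Z)) :
    sepRel (universalityClass σ M N) = sepRel (networks σ M N) :=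
  sepRel_closure _

/-- If the sums over all coordinates of `s (a * t + b)` agree at `u` and `v`, so do those of every
continuous function. -/
theorem sum_apply_eq_of_forall_dilate {ι : Type*} [Fintype ι] {s : ℝ → ℝ} (hs : Continuous s)
    (hpoly : ¬ ∃ p : Polynomial ℝ, ∀ t, s t = p.eval t) {u v : ι → ℝ}
    (h : ∀ a b, ∑ i, s (a * u i + b) = ∑ i, s (a * v i + b)) (f : C(ℝ, ℝ)) :
    ∑ i, f (u i) = ∑ i, f (v i) := by
  let S : Submodule ℝ C(ℝ, ℝ) :=
    { carrier := {f | ∑ i, f (u i) = ∑ i, f (v i)}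
      zero_mem' := by simp
      add_mem' := fun {f g} hf hg => by
        simp only [Set.mem_ofPred_eq] at hf hg ⊢
        simp [Finset.sum_add_distrib, hf, hg]
      smul_mem' := fun c f hf => by
        simp only [Set.mem_ofPred_eq] at hf ⊢
        simp [← Finset.mul_sum, hf] }
  have hS : IsClosed (S : Set C(ℝ, ℝ)) :=
    isClosed_eq (continuous_finsetSum _ fun _ _ => continuous_eval_const _)
      (continuous_finsetSum _ fun _ _ => continuous_eval_const _)
  have h1 : S = ⊤ := eq_top_of_forall_dilate_mem hS hs hpoly h
  exact (h1 ▸ Submodule.mem_top : f ∈ S)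

/-- Sums of continuous functions over the coordinates separate the orbits of the symmetric group. -/
theorem exists_perm_of_forall_sum_eq {ι : Type*} [Fintype ι] {u v : ι → ℝ}
    (h : ∀ f : C(ℝ, ℝ), ∑ i, f (u i) = ∑ i, f (v i)) : ∃ π : Equiv.Perm ι, ∀ i, v (π i) = u i := by
  classical
  have hcard : ∀ c, Fintype.card {i // u i = c} = Fintype.card {i // v i = c} := fun c => by
    -- The polynomial `f` vanishes at every value of `u` and `v` except `c`, so the two sums count
    -- the multiplicity of `c`.
    let T : Finset ℝ := (Finset.univ.image u ∪ Finset.univ.image v).erase c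
    let f : C(ℝ, ℝ) := ⟨fun t => ∏ x ∈ T, (t - x), by fun_prop⟩
    have hfc : f c ≠ 0 := Finset.prod_ne_zero_iff.2 fun x hx =>
      sub_ne_zero.2 (Finset.ne_of_mem_erase hx).symm
    have hf0 : ∀ x ∈ T, f x = 0 := fun x hx => Finset.prod_eq_zero hx (sub_self x)
    have hsum : ∀ w : ι → ℝ, (∀ i, w i ≠ c → w i ∈ T) →
        ∑ i, f (w i) = Fintype.card {i // w i = c} * f c := fun w hw => by
      rw [Fintype.card_subtype, ← nsmul_eq_mul, ← Finset.sum_const, Finset.sum_filter]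
      refine Finset.sum_congr rfl fun i _ => ?_
      split_ifs with hi
      · rw [hi]
      · exact hf0 _ (hw i hi)
    have h1 := h f
    rw [hsum u fun i hi => Finset.mem_erase.2 ⟨hi, by simp⟩,
      hsum v fun i hi => Finset.mem_erase.2 ⟨hi, by simp⟩] at h1
    exact_mod_cast mul_right_cancel₀ hfc h1
  -- Bijections between fibres of equal cardinality assemble into the permutation.
  let e : ι ≃ ι := (Equiv.sigmaFiberEquiv u).symm.trans
    ((Equiv.sigmaCongrRight fun c => Fintype.equivOfCardEq (hcard c)).trans
      (Equiv.sigmaFiberEquiv v))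
  exact ⟨e, fun i => (Fintype.equivOfCardEq (hcard (u i)) ⟨i, rfl⟩).2⟩

variable {n : ℕ} {σ : ℝ → ℝ} {Z : Type*} [AddCommGroup Z] [Module ℝ Z] [TopologicalSpace Z]
  {z : Z} {N : Submodule ℝ ((Fin n → ℝ) →ᵃ[ℝ] Z)}

/-- Points that are not separated by point-wise networks with sum pooling lie in one orbit. -/
theorem exists_perm_of_mem_sepRel [ContinuousSMul ℝ Z] (hn : 0 < n) (hσ : Continuous σ)
    (hpoly : ¬ ∃ p : Polynomial ℝ, ∀ t, σ t = p.eval t) (hz : z ≠ 0) (hN : sumLayer n z ∈ N)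
    {p : (Fin n → ℝ) × (Fin n → ℝ)} (hp : p ∈ sepRel (networks σ (convLayer n 1) N)) :
    ∃ g : SymGroup n, permRep (SymGroup n) (Fin n) g p.1 = p.2 := by
  have hs : ∀ a b, ∑ i, σ (a * p.2 i + b) = ∑ i, σ (a * p.1 i + b) := fun a b => by
    have h := hp ⟨fun v => (∑ i, σ (a * v i + b)) • z, by fun_prop⟩
      (mem_networks_of_eq (scaleShift_mem_convLayer hn le_rfl a b) hN fun v => by
        rw [sumLayer_apply]
        rfl)
    exact (smul_left_injective ℝ hz h).symm
  obtain ⟨π, hπ⟩ := exists_perm_of_forall_sum_eq (sum_apply_eq_of_forall_dilate hσ hpoly hs)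
  exact ⟨π⁻¹, funext fun i => by rw [permRep_apply, inv_inv]; exact hπ i⟩

/-- Without pooling, each output coordinate `σ (a * v i + b)` can be read off separately; the
one-point index type reduces this to the sum lemma, applied to the identity function. -/
theorem eq_of_mem_sepRel_convLayer (hn : 0 < n) (hσ : Continuous σ)
    (hpoly : ¬ ∃ p : Polynomial ℝ, ∀ t, σ t = p.eval t) {k : ℕ} (hk : 1 ≤ k)
    {p : (Fin n → ℝ) × (Fin n → ℝ)}
    (hp : p ∈ sepRel (networks σ (convLayer n 1) (convLayer n k))) : p.1 = p.2 := by
  funext i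
  have h := sum_apply_eq_of_forall_dilate (ι := Unit) (u := fun _ => p.1 i) (v := fun _ => p.2 i)
    hσ hpoly (fun a b => ?_) (ContinuousMap.id ℝ)
  · simpa using h
  · have h := hp ⟨fun v i => σ (a * v i + b), by fun_prop⟩
      (mem_networks_of_eq (scaleShift_mem_convLayer hn le_rfl a b)
        (scaleShift_mem_convLayer hn hk 1 0) fun v => by
          ext i
          simp [pointwise])
    simpa using congrFun h i

end Separation

/-! ### Annihilating functionals and the functions they detect -/

section Obstructions

variable {n : ℕ} {σ : ℝ → ℝ} {Z : Type*} [AddCommGroup Z] [Module ℝ Z] [TopologicalSpace Z]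
  [IsTopologicalAddGroup Z] [ContinuousSMul ℝ Z] {z : Z}
  {N : Submodule ℝ ((Fin n → ℝ) →ᵃ[ℝ] Z)}

/-- Functions of the coordinate sum, with values on a line, are approximated by PointNets. -/
theorem sum_comp_mem_universalityClass (hn : 0 < n) (hσ : Continuous σ)
    (hpoly : ¬ ∃ p : Polynomial ℝ, ∀ t, σ t = p.eval t) (hN : sumLayer n z ∈ N)
    {F : C(Fin n → ℝ, Z)} (f : C(ℝ, ℝ)) (hF : ∀ v, F v = f (∑ i, v i) • z) :
    F ∈ universalityClass σ (symAff n (Fin n) (Fin n)) N := by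
  let L : C(ℝ, ℝ) →L[ℝ] C(Fin n → ℝ, Z) :=
    ((ContinuousLinearMap.toSpanSingleton ℝ z).compLeftContinuous ℝ (Fin n → ℝ)).comp
      (precompCLM ℝ ⟨fun v : Fin n → ℝ => ∑ i, v i, by fun_prop⟩)
  let S := (networksSubmodule σ (symAff n (Fin n) (Fin n)) N).topologicalClosure.comap L.toLinearMap
  have hS : IsClosed (S : Set C(ℝ, ℝ)) :=
    (Submodule.isClosed_topologicalClosure _).preimage L.continuous
  have h : S = ⊤ := by
    refine eq_top_of_forall_dilate_mem hS hσ hpoly fun a b => ?_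
    refine Submodule.le_topologicalClosure _ (mem_networks_of_eq
      (f := AffineMap.pi fun _ => a • sumLayer n (1 : ℝ) + AffineMap.const ℝ _ b)
      -- All `n` hidden units carry the same value `a * ∑ v + b`; the factor `n⁻¹` compensates for
      -- summing the copies.
      (g := (n : ℝ)⁻¹ • sumLayer n z) (mem_symAff_iff.2 fun g v => ?_) (N.smul_mem _ hN)
      fun v => ?_)
    · ext i
      change a • sumLayer n (1 : ℝ) (permRep _ _ g v) + b = a • sumLayer n (1 : ℝ) v + b
      rw [sumLayer_apply, sum_permRep, sumLayer_apply]
    · have hn' : (n : ℝ) ≠ 0 := by positivity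
      have h1 : ∀ i, (AffineMap.pi fun _ : Fin n => a • sumLayer n (1 : ℝ) +
          AffineMap.const ℝ (Fin n → ℝ) b : (Fin n → ℝ) →ᵃ[ℝ] (Fin n → ℝ)) v i
            = a * ∑ i, v i + b := fun i => by
        change a • sumLayer n (1 : ℝ) v + b = _
        simp
      change σ (a * ∑ i, v i + b) • z = (n : ℝ)⁻¹ • sumLayer n z _
      simp [pointwise, h1, smul_smul, hn']
  have h1 : F = L f := by
    ext v
    exact hF v
  have h2 : f ∈ S := h ▸ Submodule.mem_top
  rw [h1]
  exact h2

variable [T2Space Z]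

/-- Point-wise networks are additive in disjointly supported arguments. -/
theorem additive_of_mem_universalityClass_convLayer (hn : 0 < n) {i j : Fin n} (hij : i ≠ j)
    {F : C(Fin n → ℝ, Z)} (hF : F ∈ universalityClass σ (convLayer n 1) N) :
    F (Pi.single i 1 + Pi.single j 1) + F 0 = F (Pi.single i 1) + F (Pi.single j 1) := by
  have h := sum_smul_eq_zero_of_mem_universalityClass (ι := Fin 4) ![1, 1, -1, -1]
    ![Pi.single i 1 + Pi.single j 1, 0, Pi.single i 1, Pi.single j 1]
    (by simp [Fin.sum_univ_succ]) (fun f hf => ?_) hF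
  · simp only [Fin.sum_univ_four, Matrix.cons_val] at h
    rw [← sub_eq_zero, ← h]
    simp only [one_smul, neg_smul]
    abel
  · obtain ⟨a, b, rfl⟩ := eq_scaleShift_of_mem_convLayer hn hf
    ext k
    simp only [Fin.sum_univ_four, Matrix.cons_val, Pi.add_apply, Pi.smul_apply, pointwise,
      scaleShift_apply, Pi.zero_apply, smul_eq_mul, Pi.single_apply]
    -- In each coordinate the four arguments cancel in pairs, because at most one of the two unit
    -- vectors is nonzero there.
    by_cases hi : k = i
    · have hj : k ≠ j := hi ▸ hij
      simp [hi, hij]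
    · simp [hi]

/-- Additivity on two unit vectors would give `2 ^ n = 2`. -/
theorem sumPow_smul_notMem (hn : 1 < n) (hz : z ≠ 0) {F : C(Fin n → ℝ, Z)}
    (hF : ∀ v, F v = sumPow n v • z) : F ∉ universalityClass σ (convLayer n 1) N := by
  intro h
  have h1 := additive_of_mem_universalityClass_convLayer (zero_lt_one.trans hn)
    (i := ⟨0, by omega⟩) (j := ⟨1, hn⟩) (by simp) h
  have hn0 : n ≠ 0 := by omega
  simp only [hF, ← add_smul] at h1
  have h2 := smul_left_injective ℝ hz h1
  simp only [sumPow, ContinuousMap.coe_mk, Pi.add_apply, Finset.sum_add_distrib, Pi.zero_apply,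
    Finset.sum_const_zero, Finset.sum_pi_single', Finset.mem_univ, if_true, zero_pow hn0,
    one_pow, add_zero] at h2
  have h3 : (1 + 1 : ℝ) ^ 1 < (1 + 1) ^ n := pow_lt_pow_right₀ (by norm_num) hn
  linarith

/-- Evaluations at points with common coordinate sum that differ only in their first `m`
coordinates, and cancel in each of these, vanish on PointNets. -/
theorem sum_smul_append_eq_zero {m k : ℕ} {N : Submodule ℝ ((Fin (m + k) → ℝ) →ᵃ[ℝ] Z)}
    {ι : Type*} [Fintype ι] (w : ι → ℝ) (a : ι → Fin m → ℝ) (r : Fin k → ℝ) (s : ℝ)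
    (hw : ∑ κ, w κ = 0) (hs : ∀ κ, ∑ j, a κ j = s)
    (ha : ∀ (φ : ℝ → ℝ) (j : Fin m), ∑ κ, w κ * φ (a κ j) = 0) {F : C(Fin (m + k) → ℝ, Z)}
    (hF : F ∈ universalityClass σ (symAff (m + k) (Fin (m + k)) (Fin (m + k))) N) :
    ∑ κ, w κ • F (Fin.append (a κ) r) = 0 := by
  refine sum_smul_eq_zero_of_mem_universalityClass w _ hw (fun f hf => ?_) hF
  ext i
  obtain ⟨A, B, C, h⟩ := exists_apply_eq_of_mem_symAff hf i
  simp only [Finset.sum_apply, Pi.smul_apply, pointwise, h, smul_eq_mul, Pi.zero_apply,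
    Fin.sum_univ_add, Fin.append_left, Fin.append_right, hs]
  -- With the coordinate sum held constant, a hidden unit among the first `m` is a function of `a κ
  -- j` alone, and one among the last `k` is constant in `κ`.
  refine Fin.addCases (fun j => ?_) (fun j => ?_) i
  · simp only [Fin.append_left]
    exact ha (fun t => σ (A * t + B * (s + ∑ j, r j) + C)) j
  · simp only [Fin.append_right, ← Finset.sum_mul, hw, zero_mul]

/-- The discriminant of the coordinates. -/
def discriminant (n : ℕ) : C(Fin n → ℝ, ℝ) :=
  ⟨fun v => ∏ i, ∏ j, if i = j then 1 else (v i - v j) ^ 2, by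
    refine continuous_finsetProd _ fun i _ => continuous_finsetProd _ fun j _ => ?_
    split_ifs <;> fun_prop⟩

theorem discriminant_apply (v : Fin n → ℝ) :
    discriminant n v = ∏ i, ∏ j, if i = j then 1 else (v i - v j) ^ 2 := rfl

theorem discriminant_permRep (g : SymGroup n) (v : Fin n → ℝ) :
    discriminant n (permRep (SymGroup n) (Fin n) g v) = discriminant n v := by
  change (∏ i, ∏ j, if i = j then (1 : ℝ) else (v (g⁻¹ i) - v (g⁻¹ j)) ^ 2) =
    ∏ i, ∏ j, if i = j then (1 : ℝ) else (v i - v j) ^ 2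
  rw [← Equiv.prod_comp g⁻¹ fun i => ∏ j, if i = j then (1 : ℝ) else (v i - v j) ^ 2]
  refine Finset.prod_congr rfl fun i _ => ?_
  rw [← Equiv.prod_comp g⁻¹ fun j => if g⁻¹ i = j then (1 : ℝ) else (v (g⁻¹ i) - v j) ^ 2]
  simp only [EmbeddingLike.apply_eq_iff_eq]

theorem discriminant_nonneg (v : Fin n → ℝ) : 0 ≤ discriminant n v := by
  rw [discriminant_apply]
  exact Finset.prod_nonneg fun i _ => Finset.prod_nonneg fun j _ => by split_ifs <;> positivity

theorem discriminant_eq_zero {v : Fin n → ℝ} {i j : Fin n} (hij : i ≠ j) (h : v i = v j) :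
    discriminant n v = 0 :=
  Finset.prod_eq_zero (Finset.mem_univ i)
    (Finset.prod_eq_zero (Finset.mem_univ j) (by simp [hij, h]))

theorem discriminant_ne_zero {v : Fin n → ℝ} (h : Function.Injective v) :
    discriminant n v ≠ 0 := by
  rw [discriminant_apply]
  exact Finset.prod_ne_zero_iff.2 fun i _ => Finset.prod_ne_zero_iff.2 fun j _ => by
    split_ifs with hij
    · exact one_ne_zero
    · exact pow_ne_zero 2 (sub_ne_zero.2 (h.ne hij))

/-- The functional has six points whose positive and negative rows list the same values in each
column, all with sum 6. Every negative row has a repeated entry, where the discriminant vanishes,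
while the positive row `(0, 2, 4)` has distinct entries. -/
theorem discriminant_smul_notMem (hn : 2 < n) (hz : z ≠ 0) {F : C(Fin n → ℝ, Z)}
    (hF : ∀ v, F v = discriminant n v • z) :
    F ∉ universalityClass σ (symAff n (Fin n) (Fin n)) N := by
  obtain ⟨k, rfl⟩ : ∃ k, n = 3 + k := ⟨n - 3, by omega⟩
  intro h
  -- The padding is injective and exceeds all entries of the six rows, so it creates no new
  -- coincidences.
  let r : Fin k → ℝ := fun j => (j : ℝ) + 10
  have h1 := sum_smul_append_eq_zero (ι := Fin 6) ![1, 1, 1, -1, -1, -1]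
    ![![0, 2, 4], ![1, 3, 2], ![2, 1, 3], ![0, 3, 3], ![1, 1, 4], ![2, 2, 2]] r 6
    (by simp [Fin.sum_univ_six])
    (fun κ => by fin_cases κ <;> simp [Fin.sum_univ_three] <;> norm_num)
    (fun φ j => by fin_cases j <;> simp [Fin.sum_univ_six] <;> ring) h
  simp only [hF, smul_smul, ← Finset.sum_smul] at h1
  have h2 := (smul_eq_zero.1 h1).resolve_right hz
  have h01 : (Fin.castAdd k (0 : Fin 3)) ≠ Fin.castAdd k 1 := by simp
  have h12 : (Fin.castAdd k (1 : Fin 3)) ≠ Fin.castAdd k 2 := by simp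
  have z1 : discriminant (3 + k) (Fin.append ![0, 3, 3] r) = 0 :=
    discriminant_eq_zero h12 (by simp only [Fin.append_left]; rfl)
  have z2 : discriminant (3 + k) (Fin.append ![1, 1, 4] r) = 0 :=
    discriminant_eq_zero h01 (by simp only [Fin.append_left]; rfl)
  have z3 : discriminant (3 + k) (Fin.append ![2, 2, 2] r) = 0 :=
    discriminant_eq_zero h01 (by simp only [Fin.append_left]; rfl)
  have p1 := discriminant_nonneg (Fin.append ![1, 3, 2] r)
  have p2 := discriminant_nonneg (Fin.append ![2, 1, 3] r)
  have p3 : 0 < discriminant (3 + k) (Fin.append ![0, 2, 4] r) := by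
    refine (discriminant_nonneg _).lt_of_ne' (discriminant_ne_zero ?_)
    refine Fin.append_injective_iff.2 ⟨fun i j hij => ?_, fun i j hij => ?_, fun i j => ?_⟩
    · fin_cases i <;> fin_cases j <;> simp_all
    · simp only [r, add_left_inj, Nat.cast_inj] at hij
      exact Fin.ext hij
    · have hj : (0 : ℝ) ≤ (j : ℝ) := by positivity
      fin_cases i <;> simp [r] <;> linarith
  simp only [Fin.sum_univ_six, Matrix.cons_val, z1, z2, z3] at h2
  linarith

/-- Four points of the form `(x, y)`, `(0, 0)`, `(x, 0)`, `(0, y)` with `x = y = (1, -1)`, padded by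
ones: the coordinate sums agree, and the product is 1 at the first point and 0 at the others. -/
theorem coordProd_notMem (hn : 3 < n) {N : Submodule ℝ ((Fin n → ℝ) →ᵃ[ℝ] ℝ)} :
    coordProd n ∉ universalityClass σ (symAff n (Fin n) (Fin n)) N := by
  obtain ⟨k, rfl⟩ : ∃ k, n = 4 + k := ⟨n - 4, by omega⟩
  intro h
  have h1 := sum_smul_append_eq_zero (ι := Fin 4) ![1, 1, -1, -1]
    ![![1, -1, 1, -1], ![0, 0, 0, 0], ![1, -1, 0, 0], ![0, 0, 1, -1]] (fun _ : Fin k => 1) 0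
    (by simp [Fin.sum_univ_four])
    (fun κ => by fin_cases κ <;> simp [Fin.sum_univ_four])
    (fun φ j => by fin_cases j <;> simp [Fin.sum_univ_four]) h
  simp [coordProd, Fin.prod_univ_add, Fin.sum_univ_four, Fin.prod_univ_four] at h1

end Obstructions

/-! ### Strict inclusions and failure of universality -/

section Comparison

variable {n : ℕ} {σ : ℝ → ℝ} {Z : Type*} [AddCommGroup Z] [Module ℝ Z] [TopologicalSpace Z]
  [ContinuousSMul ℝ Z] {z : Z} {N N' : Submodule ℝ ((Fin n → ℝ) →ᵃ[ℝ] Z)}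

/-- A continuous function with values on the line through `z`. -/
def smulConst {X : Type*} [TopologicalSpace X] (f : C(X, ℝ)) (z : Z) : C(X, Z) :=
  ⟨fun x => f x • z, by fun_prop⟩

theorem sumPow_permRep {G : Type*} [Group G] [MulAction G (Fin n)] (g : G) (v : Fin n → ℝ) :
    sumPow n (permRep G (Fin n) g v) = sumPow n v := by
  simp only [sumPow, ContinuousMap.coe_mk, sum_permRep]

theorem coordProd_permRep (g : SymGroup n) (v : Fin n → ℝ) :
    coordProd n (permRep (SymGroup n) (Fin n) g v) = coordProd n v :=
  Equiv.prod_comp g⁻¹ v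

/-- Functions on `ℝⁿ` that are constant on the orbits of the symmetric group respect the separation
relation of point-wise networks. -/
theorem mem_respecting_convLayer (hn : 0 < n) (hσ : Continuous σ)
    (hpoly : ¬ ∃ p : Polynomial ℝ, ∀ t, σ t = p.eval t) (hz : z ≠ 0) (hN : sumLayer n z ∈ N)
    {F : C(Fin n → ℝ, Z)} (hF : ∀ g v, F (permRep (SymGroup n) (Fin n) g v) = F v) :
    F ∈ respecting (sepRel (networks σ (convLayer n 1) N)) := fun p hp => by
  obtain ⟨g, hg⟩ := exists_perm_of_mem_sepRel hn hσ hpoly hz hN hp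
  rw [← hg, hF]

theorem mem_respecting_symAff (hn : 0 < n) (hσ : Continuous σ)
    (hpoly : ¬ ∃ p : Polynomial ℝ, ∀ t, σ t = p.eval t) (hz : z ≠ 0) (hN : sumLayer n z ∈ N)
    {F : C(Fin n → ℝ, Z)} (hF : ∀ g v, F (permRep (SymGroup n) (Fin n) g v) = F v) :
    F ∈ respecting (sepRel (networks σ (symAff n (Fin n) (Fin n)) N)) := fun p hp =>
  mem_respecting_convLayer hn hσ hpoly hz hN hF p
    (sepRel_anti (networks_mono (convLayer_one_le_symAff hn) le_rfl) hp)

variable [IsTopologicalAddGroup Z]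

theorem sumPow_smul_mem (hn : 0 < n) (hσ : Continuous σ)
    (hpoly : ¬ ∃ p : Polynomial ℝ, ∀ t, σ t = p.eval t) (hN : sumLayer n z ∈ N) :
    smulConst (sumPow n) z ∈ universalityClass σ (symAff n (Fin n) (Fin n)) N :=
  sum_comp_mem_universalityClass hn hσ hpoly hN (monomialMap n) fun _ => rfl

variable [T2Space Z]

/-- Point-wise networks are strictly less expressive than PointNets. -/
theorem universalityClass_convLayer_ssubset (hn : 1 < n) (hσ : Continuous σ)
    (hpoly : ¬ ∃ p : Polynomial ℝ, ∀ t, σ t = p.eval t) (hz : z ≠ 0) (hN : sumLayer n z ∈ N)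
    (hN' : N' ≤ N) :
    universalityClass σ (convLayer n 1) N' ⊂ universalityClass σ (symAff n (Fin n) (Fin n)) N :=
  ⟨universalityClass_mono (convLayer_one_le_symAff (zero_lt_one.trans hn)) hN', fun h =>
    sumPow_smul_notMem hn hz (fun _ => rfl)
      (h (sumPow_smul_mem (zero_lt_one.trans hn) hσ hpoly hN))⟩

variable {τ : Representation ℝ (SymGroup n) Z}

/-- PointNets are strictly less expressive than networks with a regular hidden representation. -/
theorem universalityClass_symAff_ssubset [FiniteDimensional ℝ Z] (hn : 2 < n) (hσ : Continuous σ)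
    (hpoly : ¬ ∃ p : Polynomial ℝ, ∀ t, σ t = p.eval t) (hz : z ≠ 0) (hτ : ∀ g, τ g z = z) :
    universalityClass σ (symAff n (Fin n) (Fin n)) (equivAff (permRep (SymGroup n) (Fin n)) τ) ⊂
      universalityClass σ (symAff n (Fin n) (SymGroup n))
        (equivAff (permRep (SymGroup n) (SymGroup n)) τ) := by
  -- PointNet limits are continuous and equivariant, and the regular class contains all such maps.
  refine ⟨fun F hF => mem_universalityClass_of_map_rep hσ hpoly _ τ F
    (map_rep_of_mem_universalityClass (fun g => (τ g).continuous_of_finiteDimensional)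
      le_rfl le_rfl hF), fun h => ?_⟩
  refine discriminant_smul_notMem (F := smulConst (discriminant n) z) hn hz (fun _ => rfl)
    (h (mem_universalityClass_of_map_rep hσ hpoly _ τ _ fun g v => ?_))
  change discriminant n _ • z = τ g (discriminant n v • z)
  rw [discriminant_permRep, map_smul, hτ]

/-- The witness `(∑ x)^n • z` is invariant, hence constant on the orbits that the networks separate,
and equivariant because `z` is fixed; yet it is no limit of networks. The discriminant plays the
same role for PointNets. -/
theorem not_isEquivSepUniversal_convLayer (hn : 1 < n) (hσ : Continuous σ)
    (hpoly : ¬ ∃ p : Polynomial ℝ, ∀ t, σ t = p.eval t) (hz : z ≠ 0) (hτ : ∀ g, τ g z = z) :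
    ¬ IsEquivSepUniversal (permRep (SymGroup n) (Fin n)) τ
      (networks σ (convLayer n 1) (equivAff (permRep (SymGroup n) (Fin n)) τ)) := by
  intro h
  refine sumPow_smul_notMem (F := smulConst (sumPow n) z) hn hz (fun _ => rfl) (h.ge ⟨?_, ?_⟩)
  · refine mem_respecting_convLayer (zero_lt_one.trans hn) hσ hpoly hz (sumLayer_mem_equivAff hτ)
      fun g v => ?_
    change sumPow n _ • z = sumPow n v • z
    rw [sumPow_permRep]
  · intro g v
    change sumPow n _ • z = τ g (sumPow n v • z)
    rw [sumPow_permRep, map_smul, hτ]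

theorem not_isEquivSepUniversal_symAff (hn : 2 < n) (hσ : Continuous σ)
    (hpoly : ¬ ∃ p : Polynomial ℝ, ∀ t, σ t = p.eval t) (hz : z ≠ 0) (hτ : ∀ g, τ g z = z) :
    ¬ IsEquivSepUniversal (permRep (SymGroup n) (Fin n)) τ
      (networks σ (symAff n (Fin n) (Fin n)) (equivAff (permRep (SymGroup n) (Fin n)) τ)) := by
  intro h
  refine discriminant_smul_notMem (F := smulConst (discriminant n) z) hn hz (fun _ => rfl)
    (h.ge ⟨?_, ?_⟩)
  · refine mem_respecting_symAff (by omega) hσ hpoly hz (sumLayer_mem_equivAff hτ)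
      fun g v => ?_
    change discriminant n _ • z = discriminant n v • z
    rw [discriminant_permRep]
  · intro g v
    change discriminant n _ • z = τ g (discriminant n v • z)
    rw [discriminant_permRep, map_smul, hτ]

theorem not_isSepUniversal_convLayer (hn : 1 < n) (hσ : Continuous σ)
    (hpoly : ¬ ∃ p : Polynomial ℝ, ∀ t, σ t = p.eval t) (hz : z ≠ 0) (hN : sumLayer n z ∈ N) :
    ¬ IsSepUniversal (networks σ (convLayer n 1) N) := by
  intro h
  refine sumPow_smul_notMem (F := smulConst (sumPow n) z) hn hz (fun _ => rfl) (h.ge ?_)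
  refine mem_respecting_convLayer (zero_lt_one.trans hn) hσ hpoly hz hN fun g v => ?_
  change sumPow n _ • z = sumPow n v • z
  rw [sumPow_permRep]

theorem not_isSepUniversal_symAff (hn : 2 < n) (hσ : Continuous σ)
    (hpoly : ¬ ∃ p : Polynomial ℝ, ∀ t, σ t = p.eval t) (hz : z ≠ 0) (hN : sumLayer n z ∈ N) :
    ¬ IsSepUniversal (networks σ (symAff n (Fin n) (Fin n)) N) := by
  intro h
  refine discriminant_smul_notMem (F := smulConst (discriminant n) z) hn hz (fun _ => rfl)
    (h.ge ?_)
  refine mem_respecting_symAff (by omega) hσ hpoly hz hN fun g v => ?_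
  change discriminant n _ • z = discriminant n v • z
  rw [discriminant_permRep]

/-- These networks separate all points, so only equivariance constrains the target, and `(∑ x)^n •
𝟙` is equivariant. -/
theorem not_isEquivSepUniversal_convLayer_convLayer (hn : 1 < n) (hσ : Continuous σ)
    (hpoly : ¬ ∃ p : Polynomial ℝ, ∀ t, σ t = p.eval t) {k : ℕ} (hk : 1 ≤ k) :
    ¬ IsEquivSepUniversal (permRep (cyclicShifts n) (Fin n)) (permRep (cyclicShifts n) (Fin n))
      (networks σ (convLayer n 1) (convLayer n k)) := by
  intro h
  have : NeZero n := ⟨by omega⟩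
  refine sumPow_smul_notMem (F := smulConst (sumPow n) (1 : Fin n → ℝ)) hn one_ne_zero
    (fun _ => rfl) (h.ge ⟨fun p hp => ?_, fun g v => ?_⟩)
  · rw [eq_of_mem_sepRel_convLayer (zero_lt_one.trans hn) hσ hpoly hk hp]
  · change sumPow n _ • _ = permRep _ _ g (sumPow n v • 1)
    rw [sumPow_permRep, map_smul]
    rfl

/-- Larger families separate more, so one reverse inclusion between the extremes collapses the
chain. -/
theorem sepRel_eq_of_subset_of_subset {X W : Type*} [TopologicalSpace X] [TopologicalSpace W]
    {A B C : Set C(X, W)} (hAB : A ⊆ B) (hBC : B ⊆ C) (h : sepRel A ⊆ sepRel C) :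
    sepRel A = sepRel B ∧ sepRel B = sepRel C :=
  ⟨(h.trans (sepRel_anti hBC)).antisymm (sepRel_anti hAB),
    ((sepRel_anti hAB).trans h).antisymm (sepRel_anti hBC)⟩

end Comparison


/-! ### Assembly of the three groups of statements -/

theorem mainTheorem2 (n : ℕ) (hn : 2 < n) (σ : ℝ → ℝ) (hσ : Continuous σ)
    (hpoly : ¬ ∃ p : Polynomial ℝ, ∀ t, σ t = p.eval t) :
    -- invariant models
    ((sepRel (cnnClass n σ) = sepRel (pointNetClass n σ) ∧
        sepRel (pointNetClass n σ) = sepRel (regularClass n σ)) ∧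
      (cnnClass n σ ⊂ pointNetClass n σ ∧ pointNetClass n σ ⊂ regularClass n σ) ∧
      (sumPow n ∈ pointNetClass n σ ∧ sumPow n ∉ cnnClass n σ) ∧
      (3 < n → coordProd n ∈ regularClass n σ ∧ coordProd n ∉ pointNetClass n σ) ∧
      ¬ IsSepUniversal (networks σ (convLayer n 1) (invLayer n)) ∧
      ¬ IsSepUniversal (networks σ (symAff n (Fin n) (Fin n)) (symInv n (Fin n)))) ∧
    -- equivariant models with output `ℝⁿ`
    ((sepRel (cnnEquivClass n 1 σ) = sepRel (pointNetEquivClass n (Fin n) σ) ∧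
        sepRel (pointNetEquivClass n (Fin n) σ) = sepRel (regularEquivClass n (Fin n) σ)) ∧
      (cnnEquivClass n 1 σ ⊂ pointNetEquivClass n (Fin n) σ ∧
        pointNetEquivClass n (Fin n) σ ⊂ regularEquivClass n (Fin n) σ) ∧
      (∀ k : ℕ, 1 ≤ k → k ≤ n →
        ¬ IsEquivSepUniversal (permRep (cyclicShifts n) (Fin n))
          (permRep (cyclicShifts n) (Fin n)) (networks σ (convLayer n 1) (convLayer n k)))) ∧
    -- equivariant models with output an arbitrary nonzero permutation representation `ℝ^Y` of `S_n`
    (∀ (Y : Type*) [Finite Y] [Nonempty Y] [MulAction (SymGroup n) Y],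
      (pointwiseEquivClass n Y σ ⊂ pointNetEquivClass n Y σ ∧
        pointNetEquivClass n Y σ ⊂ regularEquivClass n Y σ) ∧
      ¬ IsEquivSepUniversal (permRep (SymGroup n) (Fin n)) (permRep (SymGroup n) Y)
        (networks σ (convLayer n 1) (symAff n (Fin n) Y)) ∧
      ¬ IsEquivSepUniversal (permRep (SymGroup n) (Fin n)) (permRep (SymGroup n) Y)
        (networks σ (symAff n (Fin n) (Fin n)) (symAff n (Fin n) Y))) := by
  have h0 : 0 < n := by omega
  have h1 : 1 < n := by omega
  have hne : NeZero n := ⟨h0.ne'⟩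
  have hI : sumLayer n (1 : ℝ) ∈ invLayer n := sumLayer_mem_equivAff fun _ => rfl
  have hS : sumLayer n (1 : ℝ) ∈ symInv n (Fin n) := sumLayer_mem_equivAff fun _ => rfl
  have hprod : ∀ v, sumPow n v = sumPow n v • (1 : ℝ) := fun v => by rw [smul_eq_mul, mul_one]
  have hss : cnnClass n σ ⊂ pointNetClass n σ :=
    universalityClass_convLayer_ssubset h1 hσ hpoly one_ne_zero hS (invLayer_le_symInv h1)
  have hss' : pointNetClass n σ ⊂ regularClass n σ :=
    universalityClass_symAff_ssubset hn hσ hpoly one_ne_zero fun _ => rfl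
  have hY : ∀ (Y : Type _) [Finite Y] [Nonempty Y] [MulAction (SymGroup n) Y],
      pointwiseEquivClass n Y σ ⊂ pointNetEquivClass n Y σ ∧
        pointNetEquivClass n Y σ ⊂ regularEquivClass n Y σ := fun Y _ _ _ =>
    -- The all-ones vector is fixed by every permutation and is nonzero because `Y` is nonempty.
    ⟨universalityClass_convLayer_ssubset (z := (1 : Y → ℝ)) h1 hσ hpoly one_ne_zero
      (sumLayer_mem_equivAff fun _ => rfl) le_rfl,
      universalityClass_symAff_ssubset (z := (1 : Y → ℝ)) hn hσ hpoly one_ne_zero fun _ => rfl⟩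
  have hE : cnnEquivClass n 1 σ ⊂ pointNetEquivClass n (Fin n) σ :=
    universalityClass_convLayer_ssubset (z := (1 : Fin n → ℝ)) h1 hσ hpoly one_ne_zero
      (sumLayer_mem_equivAff fun _ => rfl) (convLayer_one_le_symAff h0)
  have hE' : pointNetEquivClass n (Fin n) σ ⊂ regularEquivClass n (Fin n) σ :=
    universalityClass_symAff_ssubset (z := (1 : Fin n → ℝ)) hn hσ hpoly one_ne_zero fun _ => rfl
  refine ⟨⟨sepRel_eq_of_subset_of_subset hss.1 hss'.1 ?_, ⟨hss, hss'⟩,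
    ⟨sum_comp_mem_universalityClass h0 hσ hpoly hS (monomialMap n) hprod,
      sumPow_smul_notMem h1 one_ne_zero hprod⟩,
    fun h3 => ⟨mem_universalityClass_of_map_rep hσ hpoly _ _ _ coordProd_permRep,
      coordProd_notMem h3⟩,
    not_isSepUniversal_convLayer h1 hσ hpoly one_ne_zero hI,
    not_isSepUniversal_symAff hn hσ hpoly one_ne_zero hS⟩,
    ⟨sepRel_eq_of_subset_of_subset hE.1 hE'.1 ?_, ⟨hE, hE'⟩, fun k hk _ =>
      not_isEquivSepUniversal_convLayer_convLayer h1 hσ hpoly hk⟩,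
    fun Y _ _ _ => ⟨hY Y,
      not_isEquivSepUniversal_convLayer (z := (1 : Y → ℝ)) h1 hσ hpoly one_ne_zero fun _ => rfl,
      not_isEquivSepUniversal_symAff (z := (1 : Y → ℝ)) hn hσ hpoly one_ne_zero fun _ => rfl⟩⟩
  -- Points that the smallest class cannot separate lie in one `S_n`-orbit, on which every member of
  -- the regular class is constant.
  · rw [cnnClass, sepRel_universalityClass]
    intro p hp F hF
    obtain ⟨g, hg⟩ := exists_perm_of_mem_sepRel h0 hσ hpoly one_ne_zero hI hp
    rw [← hg]
    exact (map_rep_of_mem_universalityClass (fun _ => continuous_id) le_rfl le_rfl hF g p.1).symm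
  · rw [cnnEquivClass, sepRel_universalityClass]
    intro p hp F _
    rw [eq_of_mem_sepRel_convLayer h0 hσ hpoly le_rfl hp]
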